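/- For $(x,y)\in\mathbb R^2$ put $M(x,y)=\max\{|x|,|y|\}$ and $$h(x,y)=\Big(\tfrac{x\sin M(x,y)}{\sqrt{x^2+y^2}},\ \tfrac{y\sin M(x,y)}{\sqrt{x^2+y^2}},\ \cos M(x,y)\Big),\qquad h(0,0)=(0,0,1).$$ Let $Z:\mathbb R^3\to\mathbb R^3\setminus\{0\}$ be the Zorich map, given by $Z(x,y,z)=e^z h(x,y)$ on $[-\pi/2,\pi/2]^2\times\mathbb R$ and extended to $\mathbb R^3$ by repeated reflection in the planes $x=(k+\frac12)\pi$ and $y=(l+\frac12)\pi$ ($k,l\in\mathbb Z$) in the domain and in the plane $z=0$ in the image. Let $A:\mathbb R^3\to\mathbb R^3\cup\{\infty\}$ be the Möbius map $$A(x,y,z)=(2rx,\,2ry,\,1-2r(z+1)),\qquad r=\frac1{x^2+y^2+(z+1)^2},\qquad A(0,0,-1)=\infty .$$ Define the generalized tangent map $T(\mathbf x)=A(Z(2\mathbf x))$ and, for $\lambda>0$, $T_\lambda=\lambda T:\mathbb R^3\to\mathbb R^3\cup\{\infty\}$ (with $\lambda\cdot\infty=\infty$). The iterate $T_\lambda^k$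 is undefined once an orbit has reached $\infty$. Let $O^-(\infty)=\bigcup_{k\ge1}T_\lambda^{-k}(\infty)$ and let $$I(T_\lambda)=\{\mathbf x\in\mathbb R^3\setminus O^-(\infty): T_\lambda^k(\mathbf x)\to\infty\text{ as }k\to\infty\}$$ be the escaping set. **Theorem.** Let $\lambda>0$. 1. If $\lambda\ge1$, then $\overline{I(T_\lambda)}$ is connected (and non-empty). 2. If $\lambda<1$, then $\overline{I(T_\lambda)}$ is not connected; moreover, for every $\mathbf v\in O^-(\infty)\cup I(T_\lambda)$, the singleton $\{\mathbf v\}$ is a connected component of $\overline{I(T_\lambda)}$. -/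

import Mathlib

open Filter Topology

noncomputable section

namespace TangentMap

/-- Euclidean three-space `ℝ³`. -/
abbrev E3 : Type := EuclideanSpace ℝ (Fin 3)

/-- The sign picked up when `t` is moved into `[-π/2, π/2]` by successive reflections in the
points `(k + 1/2)π`, `k ∈ ℤ`: it is `1` if the number of reflections is even, `-1` if it is odd.
(Here `t ∈ [kπ - π/2, kπ + π/2)` with `k = round (t / π)`, and `k` reflections are needed.) -/
def foldSign (t : ℝ) : ℝ := (-1 : ℝ) ^ (round (t / Real.pi) : ℤ)

/-- The point of `[-π/2, π/2]` to which `t` is moved by successive reflections in the points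
`(k + 1/2)π`, `k ∈ ℤ`. -/
def fold (t : ℝ) : ℝ := foldSign t * (t - round (t / Real.pi) * Real.pi)

/-- `M(x, y) = max {|x|, |y|}`. -/
def maxAbs (x y : ℝ) : ℝ := max |x| |y|

/-- The bi-Lipschitz map `h` from the square `[-π/2, π/2]²` onto the closed upper unit hemisphere,
`h(x, y) = (x sin M / √(x² + y²), y sin M / √(x² + y²), cos M)`.
At the origin the first two coordinates are `0 / 0 = 0`, which is the continuous extension. -/
def hemisphereMap (x y : ℝ) : E3 :=
  !₂[x * Real.sin (maxAbs x y) / √(x ^ 2 + y ^ 2),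
     y * Real.sin (maxAbs x y) / √(x ^ 2 + y ^ 2),
     Real.cos (maxAbs x y)]

/-- The Zorich map `Z`. On the beam `[-π/2, π/2]² × ℝ` it is `Z(x, y, z) = e^z h(x, y)`; it is
extended to `ℝ³` by reflecting in the planes `x = (k + 1/2)π`, `y = (l + 1/2)π` in the domain and
in the plane `z = 0` in the image. -/
def zorich (p : E3) : E3 :=
  let w := Real.exp (p 2) • hemisphereMap (fold (p 0)) (fold (p 1))
  !₂[w 0, w 1, foldSign (p 0) * foldSign (p 1) * w 2]

/-- The Möbius map `A(x, y, z) = (2rx, 2ry, 1 - 2r(z + 1))`, `r = 1 / (x² + y² + (z + 1)²)`,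
with the value `∞` at `(0, 0, -1)`. -/
def moebius (p : E3) : OnePoint E3 :=
  let d := p 0 ^ 2 + p 1 ^ 2 + (p 2 + 1) ^ 2
  open Classical in
  if d = 0 then OnePoint.infty
  else (!₂[2 * (1 / d) * p 0, 2 * (1 / d) * p 1, 1 - 2 * (1 / d) * (p 2 + 1)] : E3)

/-- The generalized tangent map `T(p) = A(Z(2p))`. -/
def genTan (p : E3) : OnePoint E3 := moebius (zorich ((2 : ℝ) • p))

/-- `T_lam = lam T`, where `lam · ∞ = ∞`. -/
def genTanScaled (lam : ℝ) (p : E3) : OnePoint E3 :=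
  OnePoint.map (fun q : E3 => lam • q) (genTan p)

section Dynamics

variable {X : Type*}

/-- `iter f k x` is the `k`-th iterate `f^k(x)` of `f : X → X ∪ {∞}`, for as long as it is defined.
The iterates that the usual convention leaves undefined (those after the orbit has hit `∞`) are
given the value `∞`, so that `iter f k x = ∞` means: `f^j(x) = ∞` for some `1 ≤ j ≤ k`. -/
def iter (f : X → OnePoint X) : ℕ → X → OnePoint X
  | 0, x => (x : OnePoint X)
  | k + 1, x => (iter f k x).elim OnePoint.infty f

/-- The backward orbit of infinity, `O⁻(∞) = ⋃_{k ≥ 1} f^{-k}(∞)`. -/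
def backwardOrbitInfty (f : X → OnePoint X) : Set X :=
  {x | ∃ k : ℕ, 1 ≤ k ∧ iter f k x = OnePoint.infty}

/-- The escaping set: the points outside `O⁻(∞)` whose iterates tend to `∞`. -/
def escapingSet [TopologicalSpace X] (f : X → OnePoint X) : Set X :=
  {x | x ∉ backwardOrbitInfty f ∧
    Tendsto (fun k : ℕ => iter f k x) atTop (𝓝 (OnePoint.infty : OnePoint X))}

end Dynamics

end TangentMap

end

noncomputable section

namespace TangentMap

/-! Everything happens in the plane z = 0. Off it, `denom` does not vanish and the third coordinate
never becomes 0. Where the image is large, |z| is small and does not decrease (`height_grows`), so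
an orbit off the plane cannot escape. In the plane the map is `planar`. On a checkerboard of squares
of side π/2 it is radial in suitable coordinates: max-norm m goes to Euclidean norm `lam * tan m` on
even squares (centred at zeros) and to `lam / tan m` on odd squares (centred at poles). The explicit
inverse branches give openness, countable fibres and, far out, contraction by 1/2
(`invPole_contract`). Hence the closure C of the planar escaping set is invariant forwards and
backwards off the poles and contains all prepoles. Moreover, a connected set without prepoles which
contains an escaping point, and whose images have bounded diameter, is a point
(`subsingleton_of_escaping`).

For `lam < 1` the lines x ± y ∈ πℤ are mapped into |x| = |y|, where orbits sink to the attracting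
origin, so these lines miss C. Images of a prepole-free connected subset of C therefore stay in
bounded diamonds, and the expansion principle applies. A connected subset of C through a pole and a
non-pole would contain a point whose image has ℓ¹-norm mπ, hence lies on such a line
(`subsingleton_of_pole`). Prepoles are reduced to poles by iteration.

For `lam ≥ 1` the function `lam * tan` stretches real intervals until they hit a pole, so prepoles
are dense on the axes, and the grid of lines x, y ∈ (π/2)ℤ, which is mapped into the axes, lies in
C. By openness each pullback of the grid is connected (`gridPull_succ_no_separation`), and by
expansion escaping points are limits of pullbacks. So C is the closure of an increasing union of
connected sets. -/

/-- The Euclidean norm on `ℝ × ℝ`, whose own norm is the maximum norm. -/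
def euc (q : ℝ × ℝ) : ℝ := √(q.1 ^ 2 + q.2 ^ 2)

/-- The folding map in the doubled variable. -/
def foldTwo (t : ℝ) : ℝ := Real.arcsin (Real.sin (2 * t))

/-- The third coordinate of the Zorich map on the plane `z = 0`, in the doubled variable. -/
def height (p : ℝ × ℝ) : ℝ :=
  (|Real.cos (2 * p.1) + Real.cos (2 * p.2)| - |Real.cos (2 * p.1) - Real.cos (2 * p.2)|) / 2

/-- The horizontal part of the hemisphere map. -/
def horiz (q : ℝ × ℝ) : ℝ × ℝ := (Real.sin ‖q‖ / euc q) • q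

/-- The scaled tangent map on the plane `z = 0`, with value `0` at the poles. -/
def planar (lam : ℝ) (p : ℝ × ℝ) : ℝ × ℝ :=
  (lam / (1 + height p)) • horiz (foldTwo p.1, foldTwo p.2)

/-- The poles of the tangent map in the plane. -/
def poles : Set (ℝ × ℝ) := {p | 1 + height p = 0}

/-! ### The Euclidean norm -/

lemma euc_nonneg (q : ℝ × ℝ) : 0 ≤ euc q := Real.sqrt_nonneg _

lemma norm_eq_max (q : ℝ × ℝ) : ‖q‖ = max |q.1| |q.2| := by
  rw [Prod.norm_def, Real.norm_eq_abs, Real.norm_eq_abs]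

lemma norm_le_euc (q : ℝ × ℝ) : ‖q‖ ≤ euc q := by
  rw [norm_eq_max, euc]
  refine max_le (Real.abs_le_sqrt ?_) (Real.abs_le_sqrt ?_)
  · nlinarith [sq_nonneg q.2]
  · nlinarith [sq_nonneg q.1]

lemma euc_le_two_norm (q : ℝ × ℝ) : euc q ≤ 2 * ‖q‖ := by
  have h1 : |q.1| ≤ ‖q‖ := by rw [norm_eq_max]; exact le_max_left _ _
  have h2 : |q.2| ≤ ‖q‖ := by rw [norm_eq_max]; exact le_max_right _ _
  have h0 := norm_nonneg q
  rw [euc]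
  apply Real.sqrt_le_iff.2 ⟨by linarith, ?_⟩
  have := sq_le_sq' (by linarith [abs_nonneg q.1]) h1
  have := sq_le_sq' (by linarith [abs_nonneg q.2]) h2
  simp only [sq_abs] at *
  nlinarith

lemma euc_pos {q : ℝ × ℝ} (h : q ≠ 0) : 0 < euc q :=
  (norm_pos_iff.2 h).trans_le (norm_le_euc q)

lemma euc_zero : euc 0 = 0 := by simp [euc]

lemma euc_smul (c : ℝ) (q : ℝ × ℝ) : euc (c • q) = |c| * euc q := by
  simp only [euc, Prod.smul_fst, Prod.smul_snd, smul_eq_mul]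
  rw [← Real.sqrt_sq_eq_abs, ← Real.sqrt_mul (sq_nonneg c)]
  congr 1; ring

lemma euc_sq (q : ℝ × ℝ) : euc q ^ 2 = q.1 ^ 2 + q.2 ^ 2 := by
  rw [euc, Real.sq_sqrt (by positivity)]

lemma continuous_euc : Continuous euc := by unfold euc; fun_prop

lemma euc_sub_le (p q : ℝ × ℝ) : |euc p - euc q| ≤ euc (p - q) := by
  have key : ∀ a b : ℝ × ℝ, euc (a + b) ≤ euc a + euc b := by
    intro a b
    have ha := euc_nonneg a
    have hb := euc_nonneg b
    have h1 := euc_sq a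
    have h2 := euc_sq b
    conv_lhs => rw [euc]
    apply Real.sqrt_le_iff.2 ⟨by linarith, ?_⟩
    have : a.1 * b.1 + a.2 * b.2 ≤ euc a * euc b := by
      refine le_of_abs_le (abs_le_of_sq_le_sq ?_ (by positivity))
      rw [mul_pow, h1, h2]
      nlinarith [sq_nonneg (a.1 * b.2 - a.2 * b.1)]
    simp only [Prod.fst_add, Prod.snd_add]
    nlinarith
  have hneg : euc (q - p) = euc (p - q) := by
    have := euc_smul (-1) (p - q)
    simpa using this
  rw [abs_le]
  constructor
  · have := key (q - p) p
    rw [sub_add_cancel] at this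
    linarith
  · have := key (p - q) q
    rw [sub_add_cancel] at this
    linarith

/-! ### Continuity -/

lemma continuous_foldTwo : Continuous foldTwo := by unfold foldTwo; fun_prop

lemma continuous_height : Continuous height := by unfold height; fun_prop

lemma euc_horiz (q : ℝ × ℝ) : euc (horiz q) = |Real.sin ‖q‖| := by
  rcases eq_or_ne q 0 with rfl | h
  · simp [horiz, euc_zero]
  · have := euc_pos h
    rw [horiz, euc_smul, abs_div, abs_of_pos this, div_mul_cancel₀ _ this.ne']

/-- The factor `sin ‖q‖ / euc q` has no limit at 0, since the ratio of the two norms depends on the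
direction; the bound by ‖q‖ settles continuity there. -/
lemma continuous_horiz : Continuous horiz := by
  rw [continuous_iff_continuousAt]
  intro q
  rcases eq_or_ne q 0 with rfl | h
  · have h0 : horiz 0 = 0 := by simp [horiz]
    rw [ContinuousAt, h0]
    refine squeeze_zero_norm (a := fun q : ℝ × ℝ => ‖q‖) (fun q => ?_) ?_
    · calc ‖horiz q‖ ≤ euc (horiz q) := norm_le_euc _
        _ = |Real.sin ‖q‖| := euc_horiz q
        _ ≤ |‖q‖| := Real.abs_sin_le_abs
        _ = ‖q‖ := abs_norm q
    · exact tendsto_norm_zero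
  · unfold horiz
    have := continuous_euc
    exact ContinuousAt.smul (ContinuousAt.div (by fun_prop) (by fun_prop) (euc_pos h).ne')
      continuousAt_id

lemma continuousAt_planar (lam : ℝ) {p : ℝ × ℝ} (hp : p ∉ poles) :
    ContinuousAt (planar lam) p := by
  unfold planar
  have h1 := continuous_horiz
  have h2 := continuous_height
  have h3 := continuous_foldTwo
  refine ContinuousAt.smul (ContinuousAt.div continuousAt_const
    (continuous_const.add h2).continuousAt hp) ?_
  exact Continuous.continuousAt (by fun_prop)

/-! ### The squares on which the planar map is a radial stretch -/

/-- The sign `(-1) ^ k`. -/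
def sgn (k : ℤ) : ℝ := (-1 : ℝ) ^ k

lemma sgn_even {k : ℤ} (h : Even k) : sgn k = 1 := h.neg_one_zpow

lemma sgn_odd {k : ℤ} (h : Odd k) : sgn k = -1 := h.neg_one_zpow

lemma sgn_cases (k : ℤ) : sgn k = 1 ∨ sgn k = -1 := by
  rcases Int.even_or_odd k with h | h
  · exact Or.inl (sgn_even h)
  · exact Or.inr (sgn_odd h)

lemma sgn_mul_self (k : ℤ) : sgn k * sgn k = 1 := by
  rcases sgn_cases k with h | h <;> rw [h] <;> norm_num

lemma abs_sgn_mul (k : ℤ) (t : ℝ) : |sgn k * t| = |t| := by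
  rcases sgn_cases k with h | h <;> rw [h] <;> simp

lemma sgn_add (k l : ℤ) : sgn (k + l) = sgn k * sgn l :=
  zpow_add₀ (by norm_num) k l

/-- Coordinate on the interval of radius `π / 4` around `k π / 2`. -/
def chartOne (k : ℤ) (a : ℝ) : ℝ := k * (Real.pi / 2) + sgn k * a

/-- Coordinates on the square around `(k π / 2, l π / 2)`. -/
def chart (k l : ℤ) (v : ℝ × ℝ) : ℝ × ℝ := (chartOne k v.1, chartOne l v.2)

/-- The reflection built into `chartOne` cancels the sign in sin(t + kπ) = (-1)^k sin t. The
horizontal part of the map is thus the same in all squares, and only the parity of k + l matters,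
through `height`. -/
lemma sin_two_chartOne (k : ℤ) (a : ℝ) : Real.sin (2 * chartOne k a) = Real.sin (2 * a) := by
  have h : 2 * chartOne k a = sgn k * (2 * a) + k * Real.pi := by unfold chartOne; ring
  rw [h, Real.sin_add_int_mul_pi]
  change sgn k * _ = _
  rcases sgn_cases k with h | h <;> rw [h] <;> simp

lemma cos_two_chartOne (k : ℤ) (a : ℝ) :
    Real.cos (2 * chartOne k a) = sgn k * Real.cos (2 * a) := by
  have h : 2 * chartOne k a = sgn k * (2 * a) + k * Real.pi := by unfold chartOne; ring
  rw [h, Real.cos_add_int_mul_pi]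
  change sgn k * _ = _
  rcases sgn_cases k with h | h <;> rw [h] <;> simp

lemma foldTwo_chartOne (k : ℤ) {a : ℝ} (ha : |a| ≤ Real.pi / 4) :
    foldTwo (chartOne k a) = 2 * a := by
  rw [foldTwo, sin_two_chartOne]
  rw [abs_le] at ha
  exact Real.arcsin_sin (by linarith) (by linarith)

lemma exists_chartOne (x : ℝ) : ∃ k : ℤ, ∃ a : ℝ, |a| ≤ Real.pi / 4 ∧ x = chartOne k a ∧
    k = round (x / (Real.pi / 2)) := by
  have hpi := Real.pi_pos
  refine ⟨round (x / (Real.pi / 2)), sgn (round (x / (Real.pi / 2))) *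
    (x - round (x / (Real.pi / 2)) * (Real.pi / 2)), ?_, ?_, rfl⟩
  · rw [abs_sgn_mul]
    have h := abs_sub_round (x / (Real.pi / 2))
    have h2 : x - round (x / (Real.pi / 2)) * (Real.pi / 2)
        = (x / (Real.pi / 2) - round (x / (Real.pi / 2))) * (Real.pi / 2) := by
      field_simp
    rw [h2, abs_mul, abs_of_pos (by positivity : (0:ℝ) < Real.pi / 2)]
    nlinarith
  · unfold chartOne
    rw [← mul_assoc, sgn_mul_self]; ring

lemma chartOne_border (k : ℤ) {a : ℝ} (ha : |a| = Real.pi / 4) :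
    ∃ k' : ℤ, ∃ a' : ℝ, Odd (k' - k) ∧ |a'| = Real.pi / 4 ∧ chartOne k a = chartOne k' a' := by
  have hpi := Real.pi_pos
  have h : |sgn k * a| = Real.pi / 4 := by rw [abs_sgn_mul, ha]
  rcases abs_eq (by positivity) |>.1 h with h1 | h1
  · refine ⟨k + 1, sgn (k + 1) * -(Real.pi / 4), ?_, ?_, ?_⟩
    · simp
    · rw [abs_sgn_mul, abs_neg, abs_of_pos (by positivity)]
    · unfold chartOne
      rw [← mul_assoc, sgn_mul_self, h1]; push_cast; ring
  · refine ⟨k - 1, sgn (k - 1) * (Real.pi / 4), ?_, ?_, ?_⟩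
    · rw [show k - 1 - k = -1 by ring]; decide
    · rw [abs_sgn_mul, abs_of_pos (by positivity)]
    · unfold chartOne
      rw [← mul_assoc, sgn_mul_self, h1]; push_cast; ring

lemma abs_chartOne_sub (k : ℤ) (a b : ℝ) : |chartOne k a - chartOne k b| = |a - b| := by
  rw [← abs_sgn_mul k (a - b)]; congr 1; unfold chartOne; ring

lemma norm_chart_sub (k l : ℤ) (v w : ℝ × ℝ) : ‖chart k l v - chart k l w‖ = ‖v - w‖ := by
  simp only [norm_eq_max, chart, Prod.fst_sub, Prod.snd_sub, abs_chartOne_sub]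

lemma continuous_chart (k l : ℤ) : Continuous (chart k l) := by
  unfold chart chartOne; fun_prop

lemma exists_chart (p : ℝ × ℝ) : ∃ k l : ℤ, ∃ v : ℝ × ℝ, ‖v‖ ≤ Real.pi / 4 ∧ p = chart k l v ∧
    k = round (p.1 / (Real.pi / 2)) ∧ l = round (p.2 / (Real.pi / 2)) := by
  obtain ⟨k, a, ha, h1, hk⟩ := exists_chartOne p.1
  obtain ⟨l, b, hb, h2, hl⟩ := exists_chartOne p.2
  exact ⟨k, l, (a, b), by rw [norm_eq_max]; exact max_le ha hb, Prod.ext h1 h2, hk, hl⟩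

lemma sub_abs_half {a b : ℝ} (ha : 0 ≤ a) (hb : 0 ≤ b) : (|a + b| - |a - b|) / 2 = min a b := by
  rw [abs_of_nonneg (by linarith)]
  rcases le_total a b with h | h
  · rw [min_eq_left h, abs_of_nonpos (by linarith)]; ring
  · rw [min_eq_right h, abs_of_nonneg (by linarith)]; ring

/-- Cosine decreases on [0, π/2], so cos(2‖v‖) is the smaller of the two nonnegative cosines. The
expression (|a + b| - |a - b|)/2 is this minimum and changes sign with either argument. -/
lemma height_chart (k l : ℤ) {v : ℝ × ℝ} (hv : ‖v‖ ≤ Real.pi / 4) :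
    height (chart k l v) = sgn (k + l) * Real.cos (2 * ‖v‖) := by
  rw [norm_eq_max] at hv ⊢
  have h1 := (le_max_left _ _).trans hv
  have h2 := (le_max_right _ _).trans hv
  have hpi := Real.pi_pos
  have hc : ∀ t : ℝ, |t| ≤ Real.pi / 4 → 0 ≤ Real.cos (2 * t) := fun t ht => by
    rw [abs_le] at ht
    exact Real.cos_nonneg_of_neg_pi_div_two_le_of_le (by linarith) (by linarith)
  have ha := hc _ h1
  have hb := hc _ h2
  have hm : Real.cos (2 * max |v.1| |v.2|) = min (Real.cos (2 * v.1)) (Real.cos (2 * v.2)) := by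
    have e : ∀ t : ℝ, Real.cos (2 * t) = Real.cos (2 * |t|) := fun t => by
      rw [← Real.cos_abs (2 * t), abs_mul]; norm_num
    rw [e v.1, e v.2]
    rcases le_total |v.1| |v.2| with h | h
    · rw [max_eq_right h, min_eq_right]
      exact Real.cos_le_cos_of_nonneg_of_le_pi (by positivity) (by linarith) (by linarith)
    · rw [max_eq_left h, min_eq_left]
      exact Real.cos_le_cos_of_nonneg_of_le_pi (by positivity) (by linarith) (by linarith)
  rw [hm, ← sub_abs_half ha hb, sgn_add]
  simp only [height, chart, cos_two_chartOne]
  rcases sgn_cases k with h | h <;> rcases sgn_cases l with h' | h' <;> rw [h, h']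
  · simp
  · simp only [one_mul, neg_mul, ← sub_eq_add_neg, sub_neg_eq_add]; ring
  · simp only [one_mul, neg_mul, mul_one]
    rw [show -Real.cos (2 * v.1) + Real.cos (2 * v.2) = -(Real.cos (2 * v.1) - Real.cos (2 * v.2)) by
      ring, show -Real.cos (2 * v.1) - Real.cos (2 * v.2)
        = -(Real.cos (2 * v.1) + Real.cos (2 * v.2)) by ring, abs_neg, abs_neg]; ring
  · simp only [neg_mul, one_mul, neg_neg, mul_neg]
    rw [show -Real.cos (2 * v.1) + -Real.cos (2 * v.2)
        = -(Real.cos (2 * v.1) + Real.cos (2 * v.2)) by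
      ring, show -Real.cos (2 * v.1) - -Real.cos (2 * v.2)
        = -(Real.cos (2 * v.1) - Real.cos (2 * v.2)) by ring, abs_neg, abs_neg]

/-! ### Radial maps and the inverse branches -/

/-- The radial map which takes max-norm `m` to Euclidean norm `φ m`. -/
def radOut (φ : ℝ → ℝ) (v : ℝ × ℝ) : ℝ × ℝ := (φ ‖v‖ / euc v) • v

/-- The radial map which takes Euclidean norm `r` to max-norm `θ r`. -/
def radIn (θ : ℝ → ℝ) (q : ℝ × ℝ) : ℝ × ℝ := (θ (euc q) / ‖q‖) • q

lemma radOut_zero (φ : ℝ → ℝ) : radOut φ 0 = 0 := by simp [radOut]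

lemma radIn_zero (θ : ℝ → ℝ) : radIn θ 0 = 0 := by simp [radIn]

lemma euc_radOut (φ : ℝ → ℝ) {v : ℝ × ℝ} (hv : v ≠ 0) : euc (radOut φ v) = |φ ‖v‖| := by
  have := euc_pos hv
  rw [radOut, euc_smul, abs_div, abs_of_pos this, div_mul_cancel₀ _ this.ne']

lemma norm_radIn (θ : ℝ → ℝ) {q : ℝ × ℝ} (hq : q ≠ 0) : ‖radIn θ q‖ = |θ (euc q)| := by
  have := norm_pos_iff.2 hq
  rw [radIn, norm_smul, norm_div, norm_norm, div_mul_cancel₀ _ this.ne', Real.norm_eq_abs]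

lemma radOut_radIn {φ θ : ℝ → ℝ} {q : ℝ × ℝ} (hq : q ≠ 0) (h0 : 0 < θ (euc q))
    (h : φ (θ (euc q)) = euc q) : radOut φ (radIn θ q) = q := by
  have h1 := euc_pos hq
  have h2 := norm_pos_iff.2 hq
  rw [radOut, norm_radIn θ hq, abs_of_pos h0, h]
  conv_lhs => enter [2]; rw [radIn]
  rw [radIn, euc_smul, abs_of_pos (by positivity), smul_smul]
  convert one_smul ℝ q
  field_simp

lemma radIn_radOut {φ θ : ℝ → ℝ} {v : ℝ × ℝ} (hv : v ≠ 0) (h0 : 0 < φ ‖v‖)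
    (h : θ (φ ‖v‖) = ‖v‖) : radIn θ (radOut φ v) = v := by
  have h1 := euc_pos hv
  have h2 := norm_pos_iff.2 hv
  rw [radIn, euc_radOut φ hv, abs_of_pos h0, h]
  conv_lhs => enter [2]; rw [radOut]
  rw [radOut, norm_smul, Real.norm_of_nonneg (by positivity), smul_smul]
  convert one_smul ℝ v
  field_simp

lemma horiz_two_smul (v : ℝ × ℝ) :
    horiz (2 * v.1, 2 * v.2) = (Real.sin (2 * ‖v‖) / euc v) • v := by
  have h : ((2 * v.1, 2 * v.2) : ℝ × ℝ) = (2 : ℝ) • v := rfl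
  rw [h, horiz, norm_smul, euc_smul, smul_smul]
  congr 1
  norm_num
  field_simp

lemma planar_chart_aux (lam : ℝ) (k l : ℤ) {v : ℝ × ℝ} (hv : ‖v‖ ≤ Real.pi / 4) :
    planar lam (chart k l v) =
      (lam / (1 + sgn (k + l) * Real.cos (2 * ‖v‖)) * (Real.sin (2 * ‖v‖) / euc v)) • v := by
  have h1 : |v.1| ≤ Real.pi / 4 := (le_max_left _ _).trans (norm_eq_max v ▸ hv)
  have h2 : |v.2| ≤ Real.pi / 4 := (le_max_right _ _).trans (norm_eq_max v ▸ hv)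
  rw [planar, height_chart k l hv]
  simp only [chart]
  rw [foldTwo_chartOne k h1, foldTwo_chartOne l h2, horiz_two_smul, smul_smul]

/-- The half-angle formula sin 2m / (1 + cos 2m) = tan m; the square covers the disc of Euclidean
radius `lam`. -/
lemma planar_chart_even (lam : ℝ) {k l : ℤ} (hkl : Even (k + l)) {v : ℝ × ℝ}
    (hv : ‖v‖ ≤ Real.pi / 4) :
    planar lam (chart k l v) = radOut (fun m => lam * Real.tan m) v := by
  have hpi := Real.pi_pos
  rw [planar_chart_aux lam k l hv, sgn_even hkl, radOut]
  have hc : 0 < Real.cos ‖v‖ :=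
    Real.cos_pos_of_mem_Ioo ⟨by linarith [norm_nonneg v], by linarith⟩
  congr 1
  rw [Real.cos_two_mul, Real.sin_two_mul, Real.tan_eq_sin_div_cos]
  rcases eq_or_ne v 0 with rfl | h
  · simp
  have := euc_pos h
  have h2 : 1 + 1 * (2 * Real.cos ‖v‖ ^ 2 - 1) = 2 * Real.cos ‖v‖ ^ 2 := by ring
  rw [h2]
  field_simp

lemma sin_norm_pos {v : ℝ × ℝ} (hv : ‖v‖ ≤ Real.pi / 4) (h : v ≠ 0) : 0 < Real.sin ‖v‖ :=
  Real.sin_pos_of_pos_of_lt_pi (norm_pos_iff.2 h) (by linarith [Real.pi_pos])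

lemma tan_norm_pos {v : ℝ × ℝ} (hv : ‖v‖ ≤ Real.pi / 4) (h : v ≠ 0) : 0 < Real.tan ‖v‖ :=
  Real.tan_pos_of_pos_of_lt_pi_div_two (norm_pos_iff.2 h) (by linarith [Real.pi_pos])

lemma tan_norm_le_one {v : ℝ × ℝ} (hv : ‖v‖ ≤ Real.pi / 4) : Real.tan ‖v‖ ≤ 1 := by
  have hpi := Real.pi_pos
  rw [← Real.tan_pi_div_four]
  exact Real.strictMonoOn_tan.monotoneOn ⟨by linarith [norm_nonneg v], by linarith⟩
    ⟨by linarith, by linarith⟩ hv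

lemma norm_eq_of_one_le_tan {v : ℝ × ℝ} (hv : ‖v‖ ≤ Real.pi / 4) (h : 1 ≤ Real.tan ‖v‖) :
    ‖v‖ = Real.pi / 4 := by
  have hpi := Real.pi_pos
  by_contra hne
  have hlt := lt_of_le_of_ne hv hne
  have := Real.strictMonoOn_tan ⟨by linarith [norm_nonneg v], by linarith⟩
    ⟨by linarith, by linarith⟩ hlt
  rw [Real.tan_pi_div_four] at this
  linarith

/-- Here sin 2m / (1 - cos 2m) = 1 / tan m; the square without its centre covers the exterior of
that disc. -/
lemma planar_chart_odd (lam : ℝ) {k l : ℤ} (hkl : Odd (k + l)) {v : ℝ × ℝ}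
    (hv : ‖v‖ ≤ Real.pi / 4) :
    planar lam (chart k l v) = radOut (fun m => lam / Real.tan m) v := by
  rw [planar_chart_aux lam k l hv, sgn_odd hkl, radOut]
  rcases eq_or_ne v 0 with rfl | h
  · simp
  congr 1
  have hs := sin_norm_pos hv h
  rw [Real.cos_two_mul, Real.sin_two_mul, Real.tan_eq_sin_div_cos]
  have := euc_pos h
  have h2 : 1 + -1 * (2 * Real.cos ‖v‖ ^ 2 - 1) = 2 * Real.sin ‖v‖ ^ 2 := by
    rw [Real.sin_sq]; ring
  rw [h2]
  field_simp

lemma chart_notMem_poles_even {k l : ℤ} (hkl : Even (k + l)) {v : ℝ × ℝ}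
    (hv : ‖v‖ ≤ Real.pi / 4) : chart k l v ∉ poles := by
  have hpi := Real.pi_pos
  intro h
  rw [poles, Set.mem_ofPred_eq, height_chart k l hv, sgn_even hkl, one_mul] at h
  have := Real.cos_nonneg_of_neg_pi_div_two_le_of_le (x := 2 * ‖v‖)
    (by linarith [norm_nonneg v]) (by linarith)
  linarith

lemma chart_mem_poles_odd {k l : ℤ} (hkl : Odd (k + l)) {v : ℝ × ℝ}
    (hv : ‖v‖ ≤ Real.pi / 4) : chart k l v ∈ poles ↔ v = 0 := by
  rw [poles, Set.mem_ofPred_eq, height_chart k l hv, sgn_odd hkl]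
  constructor
  · intro h
    by_contra h0
    have hs := sin_norm_pos hv h0
    rw [Real.cos_two_mul, Real.cos_sq'] at h
    nlinarith
  · rintro rfl; simp

lemma euc_planar_even {lam : ℝ} (hlam : 0 < lam) {k l : ℤ} (hkl : Even (k + l)) {v : ℝ × ℝ}
    (hv : ‖v‖ ≤ Real.pi / 4) : euc (planar lam (chart k l v)) = lam * Real.tan ‖v‖ := by
  rw [planar_chart_even lam hkl hv]
  rcases eq_or_ne v 0 with rfl | h
  · simp [radOut_zero, euc_zero]
  · have := tan_norm_pos hv h
    rw [euc_radOut _ h, abs_of_pos (by positivity)]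

lemma euc_planar_odd {lam : ℝ} (hlam : 0 < lam) {k l : ℤ} (hkl : Odd (k + l)) {v : ℝ × ℝ}
    (hv : ‖v‖ ≤ Real.pi / 4) : euc (planar lam (chart k l v)) = lam / Real.tan ‖v‖ := by
  rw [planar_chart_odd lam hkl hv]
  rcases eq_or_ne v 0 with rfl | h
  · simp [radOut_zero, euc_zero]
  · have := tan_norm_pos hv h
    rw [euc_radOut _ h, abs_of_pos (by positivity)]

/-- The inverse of the tangent map on a square containing a zero. -/
def invZero (lam : ℝ) : ℝ × ℝ → ℝ × ℝ := radIn fun r => Real.arctan (r / lam)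

/-- The inverse of the tangent map on a square containing a pole. -/
def invPole (lam : ℝ) : ℝ × ℝ → ℝ × ℝ := radIn fun r => Real.arctan (lam / r)

lemma invZero_planar {lam : ℝ} (hlam : 0 < lam) {k l : ℤ} (hkl : Even (k + l)) {v : ℝ × ℝ}
    (hv : ‖v‖ ≤ Real.pi / 4) : invZero lam (planar lam (chart k l v)) = v := by
  rw [planar_chart_even lam hkl hv]
  have hpi := Real.pi_pos
  rcases eq_or_ne v 0 with rfl | h
  · rw [radOut_zero, invZero, radIn_zero]
  · have := tan_norm_pos hv h
    refine radIn_radOut h (by positivity) ?_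
    rw [mul_div_cancel_left₀ _ hlam.ne', Real.arctan_tan] <;> linarith [norm_nonneg v]

lemma invPole_planar {lam : ℝ} (hlam : 0 < lam) {k l : ℤ} (hkl : Odd (k + l)) {v : ℝ × ℝ}
    (hv : ‖v‖ ≤ Real.pi / 4) : invPole lam (planar lam (chart k l v)) = v := by
  rw [planar_chart_odd lam hkl hv]
  have hpi := Real.pi_pos
  rcases eq_or_ne v 0 with rfl | h
  · rw [radOut_zero, invPole, radIn_zero]
  · have := tan_norm_pos hv h
    refine radIn_radOut h (by positivity) ?_
    rw [div_div_cancel₀ hlam.ne', Real.arctan_tan] <;> linarith [norm_nonneg v]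

lemma norm_invZero_le {lam : ℝ} (hlam : 0 < lam) {q : ℝ × ℝ} (hq : euc q ≤ lam) :
    ‖invZero lam q‖ ≤ Real.pi / 4 := by
  have hpi := Real.pi_pos
  rcases eq_or_ne q 0 with rfl | h
  · rw [invZero, radIn_zero, norm_zero]; positivity
  · rw [invZero, norm_radIn _ h, ← Real.arctan_one]
    have h0 := euc_nonneg q
    rw [abs_of_nonneg (Real.arctan_nonneg.2 (by positivity))]
    exact Real.arctan_mono ((div_le_one hlam).2 hq)

lemma norm_invPole_le {lam : ℝ} (hlam : 0 < lam) {q : ℝ × ℝ} (hq : lam ≤ euc q) :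
    ‖invPole lam q‖ ≤ Real.pi / 4 := by
  have hpi := Real.pi_pos
  have h0 : 0 < euc q := hlam.trans_le hq
  have h : q ≠ 0 := by rintro rfl; rw [euc_zero] at h0; exact lt_irrefl _ h0
  rw [invPole, norm_radIn _ h, ← Real.arctan_one]
  rw [abs_of_nonneg (Real.arctan_nonneg.2 (by positivity))]
  exact Real.arctan_mono ((div_le_one h0).2 hq)

lemma planar_invZero {lam : ℝ} (hlam : 0 < lam) {k l : ℤ} (hkl : Even (k + l)) {q : ℝ × ℝ}
    (hq : euc q ≤ lam) : planar lam (chart k l (invZero lam q)) = q := by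
  rw [planar_chart_even lam hkl (norm_invZero_le hlam hq)]
  rcases eq_or_ne q 0 with rfl | h
  · rw [invZero, radIn_zero, radOut_zero]
  · have h0 := euc_pos h
    refine radOut_radIn h (Real.arctan_pos.2 (by positivity)) ?_
    rw [Real.tan_arctan]; field_simp

lemma planar_invPole {lam : ℝ} (hlam : 0 < lam) {k l : ℤ} (hkl : Odd (k + l)) {q : ℝ × ℝ}
    (hq : lam ≤ euc q) : planar lam (chart k l (invPole lam q)) = q := by
  rw [planar_chart_odd lam hkl (norm_invPole_le hlam hq)]
  have h0 : 0 < euc q := hlam.trans_le hq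
  have h : q ≠ 0 := by rintro rfl; rw [euc_zero] at h0; exact lt_irrefl _ h0
  refine radOut_radIn h (Real.arctan_pos.2 (by positivity)) ?_
  rw [Real.tan_arctan]; field_simp

lemma invPole_ne_zero {lam : ℝ} (hlam : 0 < lam) {q : ℝ × ℝ} (hq : q ≠ 0) :
    invPole lam q ≠ 0 := by
  have h0 := euc_pos hq
  rw [← norm_pos_iff, invPole, norm_radIn _ hq]
  exact abs_pos.2 (Real.arctan_pos.2 (by positivity)).ne'

/-- Crossing an edge changes one index by one, so a border point may be assigned to a square of
either parity. -/
lemma exists_square_border (k l : ℤ) {v : ℝ × ℝ} (hv : ‖v‖ = Real.pi / 4) :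
    ∃ k' l' : ℤ, ∃ v' : ℝ × ℝ, Odd (k' + l' - (k + l)) ∧ ‖v'‖ ≤ Real.pi / 4 ∧
      chart k l v = chart k' l' v' := by
  rw [norm_eq_max] at hv
  have h1 : |v.1| ≤ Real.pi / 4 := hv ▸ le_max_left _ _
  have h2 : |v.2| ≤ Real.pi / 4 := hv ▸ le_max_right _ _
  rcases max_choice |v.1| |v.2| with h | h
  · obtain ⟨k', a', ho, ha, he⟩ := chartOne_border k (h ▸ hv)
    refine ⟨k', l, (a', v.2), ?_, ?_, ?_⟩
    · rwa [show k' + l - (k + l) = k' - k by ring]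
    · rw [norm_eq_max]; exact max_le ha.le h2
    · rw [chart, he]; rfl
  · obtain ⟨l', b', ho, hb, he⟩ := chartOne_border l (h ▸ hv)
    refine ⟨k, l', (v.1, b'), ?_, ?_, ?_⟩
    · rwa [show k + l' - (k + l) = l' - l by ring]
    · rw [norm_eq_max]; exact max_le h1 hb.le
    · rw [chart, he]; rfl

/-- On an odd square the image has Euclidean norm `lam / tan ‖v‖ ≥ lam`, so only border points are
left there, and these also belong to an even square. -/
lemma exists_even_square {lam : ℝ} (hlam : 0 < lam) {p : ℝ × ℝ} (hp : p ∉ poles)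
    (h : euc (planar lam p) ≤ lam) :
    ∃ k l : ℤ, ∃ v : ℝ × ℝ, Even (k + l) ∧ ‖v‖ ≤ Real.pi / 4 ∧ p = chart k l v := by
  obtain ⟨k, l, v, hv, rfl, -, -⟩ := exists_chart p
  rcases Int.even_or_odd (k + l) with he | ho
  · exact ⟨k, l, v, he, hv, rfl⟩
  · rw [chart_mem_poles_odd ho hv] at hp
    have ht := tan_norm_pos hv hp
    rw [euc_planar_odd hlam ho hv, div_le_iff₀ ht] at h
    obtain ⟨k', l', v', h1, h2, h3⟩ := exists_square_border k l
      (norm_eq_of_one_le_tan hv (by nlinarith))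
    refine ⟨k', l', v', ?_, h2, h3⟩
    simpa using h1.add_odd ho

lemma exists_odd_square {lam : ℝ} (hlam : 0 < lam) {p : ℝ × ℝ}
    (h : p ∈ poles ∨ lam ≤ euc (planar lam p)) :
    ∃ k l : ℤ, ∃ v : ℝ × ℝ, Odd (k + l) ∧ ‖v‖ ≤ Real.pi / 4 ∧ p = chart k l v := by
  obtain ⟨k, l, v, hv, rfl, -, -⟩ := exists_chart p
  rcases Int.even_or_odd (k + l) with he | ho
  · rcases h with h | h
    · exact absurd h (chart_notMem_poles_even he hv)
    · rw [euc_planar_even hlam he hv] at h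
      obtain ⟨k', l', v', h1, h2, h3⟩ := exists_square_border k l
        (norm_eq_of_one_le_tan hv (by nlinarith))
      refine ⟨k', l', v', ?_, h2, h3⟩
      simpa using h1.add_even he
  · exact ⟨k, l, v, ho, hv, rfl⟩

/-! ### Openness and countable fibres -/

lemma continuousAt_invPole {lam : ℝ} {q : ℝ × ℝ} (hq : q ≠ 0) :
    ContinuousAt (invPole lam) q := by
  unfold invPole radIn
  have h := continuous_euc
  have h1 : ContinuousAt (fun q => lam / euc q) q :=
    continuousAt_const.div h.continuousAt (euc_pos hq).ne'
  exact ((Real.continuous_arctan.continuousAt.comp h1).div continuous_norm.continuousAt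
    (norm_pos_iff.2 hq).ne').smul continuousAt_id

lemma continuous_invZero (lam : ℝ) : Continuous (invZero lam) := by
  have h := continuous_euc
  rw [continuous_iff_continuousAt]
  intro q
  rcases eq_or_ne q 0 with rfl | hq
  · rw [ContinuousAt, invZero, radIn_zero]
    refine squeeze_zero_norm (a := fun q : ℝ × ℝ => |Real.arctan (euc q / lam)|)
      (fun q => ?_) ?_
    · rcases eq_or_ne q 0 with rfl | hq
      · rw [radIn_zero, norm_zero]; exact abs_nonneg _
      · exact (norm_radIn _ hq).le
    · have : Continuous fun q : ℝ × ℝ => |Real.arctan (euc q / lam)| := by fun_prop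
      have := this.tendsto 0
      simpa [euc_zero] using this
  · unfold invZero radIn
    have h1 : Continuous (fun q => Real.arctan (euc q / lam)) := by fun_prop
    exact (h1.continuousAt.div continuous_norm.continuousAt
      (norm_pos_iff.2 hq).ne').smul continuousAt_id

/-- The tangent map is open, in terms of closures. -/
theorem mem_closure_preimage {lam : ℝ} (hlam : 0 < lam) {p : ℝ × ℝ} (hp : p ∉ poles)
    {S : Set (ℝ × ℝ)} (h : planar lam p ∈ closure S) :
    p ∈ closure {q | q ∉ poles ∧ planar lam q ∈ S} := by
  -- The target is cut along the circle of radius `lam`, since each side has its own continuous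
  -- inverse branch.
  have hS : S = (S ∩ {q | euc q ≤ lam}) ∪ (S ∩ {q | lam ≤ euc q}) := by
    rw [← Set.inter_union_distrib_left, eq_comm, Set.inter_eq_left]
    exact fun q _ => le_total (euc q) lam
  rw [hS, closure_union] at h
  rcases h with h | h
  · have hF : euc (planar lam p) ≤ lam :=
      (isClosed_le continuous_euc continuous_const).closure_subset_iff.2
        Set.inter_subset_right h
    obtain ⟨k, l, v, he, hv, rfl⟩ := exists_even_square hlam hp hF
    have hc : ContinuousAt (fun q => chart k l (invZero lam q)) (planar lam (chart k l v)) :=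
      ((continuous_chart k l).comp (continuous_invZero lam)).continuousAt
    have := mem_closure_image hc h
    simp only [invZero_planar hlam he hv] at this
    refine closure_mono ?_ this
    rintro _ ⟨q, ⟨hq, hq'⟩, rfl⟩
    refine ⟨chart_notMem_poles_even he (norm_invZero_le hlam hq'), ?_⟩
    simp only [planar_invZero hlam he hq']
    exact hq
  · have hF : lam ≤ euc (planar lam p) :=
      (isClosed_le continuous_const continuous_euc).closure_subset_iff.2
        Set.inter_subset_right h
    have h0 : ∀ q : ℝ × ℝ, lam ≤ euc q → q ≠ 0 := by
      rintro _ hq rfl; rw [euc_zero] at hq; linarith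
    obtain ⟨k, l, v, ho, hv, rfl⟩ := exists_odd_square hlam (Or.inr hF)
    have hc : ContinuousAt (fun q => chart k l (invPole lam q)) (planar lam (chart k l v)) :=
      (continuous_chart k l).continuousAt.comp (continuousAt_invPole (h0 _ hF))
    have := mem_closure_image hc h
    simp only [invPole_planar hlam ho hv] at this
    refine closure_mono ?_ this
    rintro _ ⟨q, ⟨hq, hq'⟩, rfl⟩
    refine ⟨?_, ?_⟩
    · rw [chart_mem_poles_odd ho (norm_invPole_le hlam hq')]
      exact invPole_ne_zero hlam (h0 _ hq')
    · simp only [planar_invPole hlam ho hq']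
      exact hq

lemma arctan_sub_le {a b : ℝ} : |Real.arctan a - Real.arctan b| ≤ |a - b| := by
  have := Convex.norm_image_sub_le_of_norm_deriv_le (f := Real.arctan) (C := 1)
    (s := Set.univ) (x := b) (y := a) (fun x _ => Real.differentiable_arctan x)
    (fun x _ => by
      rw [Real.deriv_arctan, Real.norm_eq_abs, abs_of_pos (by positivity)]
      rw [div_le_one (by positivity)]; nlinarith [sq_nonneg x]) convex_univ trivial trivial
  simpa using this

lemma arctan_le_self {a : ℝ} (ha : 0 ≤ a) : Real.arctan a ≤ a := by
  have := arctan_sub_le (a := a) (b := 0)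
  rw [Real.arctan_zero, sub_zero, sub_zero, abs_of_nonneg ha] at this
  exact (le_abs_self _).trans this

lemma norm_invPole_le_div {lam : ℝ} (hlam : 0 < lam) (q : ℝ × ℝ) :
    ‖invPole lam q‖ ≤ lam / euc q := by
  have h0 := euc_nonneg q
  rcases eq_or_ne q 0 with rfl | h
  · rw [invPole, radIn_zero, norm_zero]; positivity
  · rw [invPole, norm_radIn _ h, abs_of_nonneg (Real.arctan_nonneg.2 (by positivity))]
    exact arctan_le_self (by positivity)

/-- Every pole is a limit of points which are mapped into a given unbounded set. -/
theorem pole_mem_closure_preimage {lam : ℝ} (hlam : 0 < lam) {p : ℝ × ℝ} (hp : p ∈ poles)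
    {S : Set (ℝ × ℝ)} (h : ∀ R : ℝ, ∃ q ∈ S, R ≤ ‖q‖) :
    p ∈ closure {q | q ∉ poles ∧ planar lam q ∈ S} := by
  obtain ⟨k, l, v, ho, hv, rfl⟩ := exists_odd_square hlam (Or.inl hp)
  rw [chart_mem_poles_odd ho hv] at hp
  subst hp
  rw [Metric.mem_closure_iff]
  intro ε hε
  -- This bound gives both `lam ≤ euc q`, so that the branch at the pole applies, and `lam / euc q <
  -- ε`.
  obtain ⟨q, hq, hR⟩ := h (lam + 2 * lam / ε)
  have hR' : lam + 2 * lam / ε ≤ euc q := hR.trans (norm_le_euc q)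
  have hpos : 0 < lam / ε := by positivity
  have hl : lam ≤ euc q := by linarith [show 2 * lam / ε = 2 * (lam / ε) by ring]
  have h0 : q ≠ 0 := by rintro rfl; rw [euc_zero] at hl; linarith
  refine ⟨chart k l (invPole lam q), ⟨?_, ?_⟩, ?_⟩
  · rw [chart_mem_poles_odd ho (norm_invPole_le hlam hl)]
    exact invPole_ne_zero hlam h0
  · rwa [planar_invPole hlam ho hl]
  · rw [dist_comm, dist_eq_norm, norm_chart_sub, sub_zero]
    refine (norm_invPole_le_div hlam q).trans_lt ?_
    have := euc_pos h0
    rw [div_lt_iff₀ this]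
    have h2 : lam / ε < euc q := by linarith [show 2 * lam / ε = 2 * (lam / ε) by ring]
    rw [div_lt_iff₀ hε] at h2
    linarith

/-- Each preimage is one of two inverse branches placed in one of countably many squares. -/
theorem countable_fibre {lam : ℝ} (hlam : 0 < lam) (q : ℝ × ℝ) :
    {p | planar lam p = q}.Countable := by
  have : {p | planar lam p = q} ⊆ Set.range (fun k : ℤ × ℤ => chart k.1 k.2 (invZero lam q)) ∪
      Set.range (fun k : ℤ × ℤ => chart k.1 k.2 (invPole lam q)) := by
    rintro p rfl
    obtain ⟨k, l, v, hv, rfl, -, -⟩ := exists_chart p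
    rcases Int.even_or_odd (k + l) with he | ho
    · exact Or.inl ⟨(k, l), by simp only [invZero_planar hlam he hv]⟩
    · exact Or.inr ⟨(k, l), by simp only [invPole_planar hlam ho hv]⟩
  exact ((Set.countable_range _).union (Set.countable_range _)).mono this

theorem countable_poles : poles.Countable := by
  have : poles ⊆ Set.range (fun k : ℤ × ℤ => chart k.1 k.2 0) := by
    intro p hp
    obtain ⟨k, l, v, hv, rfl, -, -⟩ := exists_chart p
    rcases Int.even_or_odd (k + l) with he | ho
    · exact absurd hp (chart_notMem_poles_even he hv)
    · rw [chart_mem_poles_odd ho hv] at hp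
      exact ⟨(k, l), by rw [hp]⟩
  exact (Set.countable_range _).mono this

/-! ### Expansion near the poles -/

/-- The branch is the angle arctan(lam / euc q) times the direction q / ‖q‖. For ‖q‖ ≥ R the angle
is at most lam/R with Lipschitz constant 2 lam/R², and the direction has Lipschitz constant 2/R. The
product rule gives 4 lam/R² ≤ 1/2. -/
lemma invPole_contract {lam R : ℝ} (hlam : 0 < lam) (hR : 0 < R) (h8 : 8 * lam ≤ R ^ 2)
    {q q' : ℝ × ℝ} (hq : R ≤ ‖q‖) (hq' : R ≤ ‖q'‖) :
    ‖invPole lam q - invPole lam q'‖ ≤ ‖q - q'‖ / 2 := by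
  have n1 : 0 < ‖q‖ := hR.trans_le hq
  have n2 : 0 < ‖q'‖ := hR.trans_le hq'
  have e1 := n1.trans_le (norm_le_euc q)
  have e2 := n2.trans_le (norm_le_euc q')
  have d0 := norm_nonneg (q - q')
  set α := Real.arctan (lam / euc q)
  set β := Real.arctan (lam / euc q')
  have ha : |α| ≤ lam / R := by
    rw [abs_of_nonneg (Real.arctan_nonneg.2 (by positivity))]
    refine (arctan_le_self (by positivity)).trans ?_
    exact div_le_div_of_nonneg_left hlam.le hR (hq.trans (norm_le_euc q))
  have hab : |α - β| ≤ 2 * lam * ‖q - q'‖ / R ^ 2 := by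
    refine arctan_sub_le.trans ?_
    have : lam / euc q - lam / euc q' = lam * (euc q' - euc q) / (euc q * euc q') := by
      field_simp
    rw [this, abs_div, abs_mul, abs_of_pos hlam, abs_of_pos (mul_pos e1 e2)]
    have h1 : |euc q' - euc q| ≤ 2 * ‖q - q'‖ := by
      rw [abs_sub_comm]; exact (euc_sub_le q q').trans (euc_le_two_norm _)
    have h2 : R ^ 2 ≤ euc q * euc q' := by
      rw [pow_two]
      exact mul_le_mul (hq.trans (norm_le_euc q)) (hq'.trans (norm_le_euc q')) hR.le e1.le
    refine div_le_div₀ (by positivity) ?_ (by positivity) h2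
    nlinarith
  have hdir : ‖(‖q‖⁻¹ : ℝ) • q - (‖q'‖⁻¹ : ℝ) • q'‖ ≤ 2 * ‖q - q'‖ / R := by
    have : (‖q‖⁻¹ : ℝ) • q - (‖q'‖⁻¹ : ℝ) • q'
        = (‖q‖⁻¹ : ℝ) • (q - q') + (‖q‖⁻¹ - ‖q'‖⁻¹ : ℝ) • q' := by
      rw [smul_sub, sub_smul]; abel
    rw [this]
    refine (norm_add_le _ _).trans ?_
    rw [norm_smul, norm_smul, norm_inv, norm_norm, Real.norm_eq_abs]
    have h3 : |‖q‖⁻¹ - ‖q'‖⁻¹| * ‖q'‖ = |‖q'‖ - ‖q‖| / ‖q‖ := by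
      rw [show ‖q‖⁻¹ - ‖q'‖⁻¹ = (‖q'‖ - ‖q‖) / (‖q‖ * ‖q'‖) by field_simp, abs_div,
        abs_of_pos (mul_pos n1 n2)]
      field_simp
    rw [h3]
    have h4 : |‖q'‖ - ‖q‖| ≤ ‖q - q'‖ := by
      rw [abs_sub_comm]; exact abs_norm_sub_norm_le q q'
    have h5 : ‖q‖⁻¹ * ‖q - q'‖ ≤ ‖q - q'‖ / R := by
      rw [inv_mul_eq_div]; exact div_le_div_of_nonneg_left d0 hR hq
    have h6 : |‖q'‖ - ‖q‖| / ‖q‖ ≤ ‖q - q'‖ / R := div_le_div₀ d0 h4 hR hq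
    calc _ ≤ _ := add_le_add h5 h6
      _ = _ := by ring
  have hsplit : invPole lam q - invPole lam q'
      = α • ((‖q‖⁻¹ : ℝ) • q - (‖q'‖⁻¹ : ℝ) • q') + (α - β) • ((‖q'‖⁻¹ : ℝ) • q') := by
    simp only [invPole, radIn, div_eq_mul_inv, mul_smul, smul_sub, sub_smul]
    simp only [α, β, div_eq_mul_inv]
    abel
  rw [hsplit]
  refine (norm_add_le _ _).trans ?_
  rw [norm_smul, norm_smul, norm_smul, norm_inv, norm_norm, inv_mul_cancel₀ n2.ne', mul_one,
    Real.norm_eq_abs, Real.norm_eq_abs]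
  calc _ ≤ lam / R * (2 * ‖q - q'‖ / R) + 2 * lam * ‖q - q'‖ / R ^ 2 :=
        add_le_add (mul_le_mul ha hdir (norm_nonneg _) (by positivity)) hab
    _ = (4 * lam / R ^ 2) * ‖q - q'‖ := by field_simp; ring
    _ ≤ (1 / 2) * ‖q - q'‖ := by
        refine mul_le_mul_of_nonneg_right ?_ d0
        rw [div_le_div_iff₀ (by positivity) (by norm_num)]; linarith
    _ = _ := by ring

/-! ### Prepoles, the planar escaping set and the invariance of its closure -/

/-- The points of the plane whose orbits hit a pole. -/
def prepoles (lam : ℝ) : Set (ℝ × ℝ) := {p | ∃ k : ℕ, (planar lam)^[k] p ∈ poles}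

/-- The escaping set of the planar map. -/
def planarEsc (lam : ℝ) : Set (ℝ × ℝ) :=
  {p | p ∉ prepoles lam ∧ Tendsto (fun k : ℕ => ‖(planar lam)^[k] p‖) atTop atTop}

lemma poles_subset_prepoles (lam : ℝ) : poles ⊆ prepoles lam := fun _ hp => ⟨0, hp⟩

lemma mem_prepoles_iff {lam : ℝ} {p : ℝ × ℝ} (hp : p ∉ poles) :
    p ∈ prepoles lam ↔ planar lam p ∈ prepoles lam := by
  constructor
  · rintro ⟨k, hk⟩
    cases k with
    | zero => exact absurd hk hp
    | succ k => exact ⟨k, by rwa [Function.iterate_succ_apply] at hk⟩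
  · rintro ⟨k, hk⟩
    exact ⟨k + 1, by rwa [Function.iterate_succ_apply]⟩

lemma mem_planarEsc_iff {lam : ℝ} {p : ℝ × ℝ} (hp : p ∉ poles) :
    p ∈ planarEsc lam ↔ planar lam p ∈ planarEsc lam := by
  refine and_congr (not_congr (mem_prepoles_iff hp)) ?_
  simp only [← Function.iterate_succ_apply]
  exact (tendsto_add_atTop_iff_nat (f := fun k : ℕ => ‖(planar lam)^[k] p‖) 1).symm

lemma notMem_poles_of_mem_planarEsc {lam : ℝ} {p : ℝ × ℝ} (hp : p ∈ planarEsc lam) :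
    p ∉ poles := fun h => hp.1 (poles_subset_prepoles lam h)

lemma closure_planarEsc_forward {lam : ℝ} {p : ℝ × ℝ} (hp : p ∉ poles)
    (h : p ∈ closure (planarEsc lam)) : planar lam p ∈ closure (planarEsc lam) := by
  refine closure_mono ?_ (mem_closure_image (continuousAt_planar lam hp) h)
  rintro _ ⟨q, hq, rfl⟩
  exact (mem_planarEsc_iff (notMem_poles_of_mem_planarEsc hq)).1 hq

/-- Openness of the map plays the role that continuity plays for the forward direction. -/
lemma closure_planarEsc_backward {lam : ℝ} (hlam : 0 < lam) {p : ℝ × ℝ} (hp : p ∉ poles)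
    (h : planar lam p ∈ closure (planarEsc lam)) : p ∈ closure (planarEsc lam) := by
  refine closure_mono ?_ (mem_closure_preimage hlam hp h)
  rintro q ⟨hq, hq'⟩
  exact (mem_planarEsc_iff hq).2 hq'

/-! ### Connected sets of reals -/

lemma IsPreconnected.abs_sub_lt_of_avoid {S : Set ℝ} (hS : IsPreconnected S) {c d : ℝ}
    (hc : 0 < c) (h : ∀ n : ℤ, n * c + d ∉ S) {a b : ℝ} (ha : a ∈ S) (hb : b ∈ S) :
    |a - b| < c := by
  wlog hab : a ≤ b generalizing a b
  · rw [abs_sub_comm]; exact this hb ha (le_of_not_ge hab)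
  rw [abs_sub_comm, abs_of_nonneg (by linarith)]
  by_contra! hlt
  -- The least point of the progression that is at least a; it is below a + c ≤ b.
  refine h ⌈(a - d) / c⌉ (hS.ordConnected.out ha hb ⟨?_, ?_⟩)
  · have := Int.le_ceil ((a - d) / c)
    rw [div_le_iff₀ hc] at this; linarith
  · have := (Int.ceil_lt_add_one ((a - d) / c)).le
    have h2 : ((⌈(a - d) / c⌉ : ℤ) : ℝ) * c ≤ ((a - d) / c + 1) * c :=
      mul_le_mul_of_nonneg_right this hc.le
    rw [add_mul, div_mul_cancel₀ _ hc.ne'] at h2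
    linarith

lemma IsPreconnected.round_eq_of_avoid {S : Set ℝ} (hS : IsPreconnected S)
    (h : ∀ n : ℤ, (n : ℝ) + 1 / 2 ∉ S) {a b : ℝ} (ha : a ∈ S) (hb : b ∈ S) :
    round a = round b := by
  wlog hab : a ≤ b generalizing a b
  · exact (this hb ha (le_of_not_ge hab)).symm
  by_contra hne
  simp only [round_eq] at hne
  have hlt : ⌊a + 1 / 2⌋ < ⌊b + 1 / 2⌋ :=
    lt_of_le_of_ne (Int.floor_mono (by linarith)) hne
  refine h ⌊a + 1 / 2⌋ (hS.ordConnected.out ha hb ⟨?_, ?_⟩)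
  · have := Int.lt_floor_add_one (a + 1 / 2)
    linarith
  · have := Int.floor_le (b + 1 / 2)
    have h2 : ((⌊a + 1 / 2⌋ : ℤ) : ℝ) + 1 ≤ ⌊b + 1 / 2⌋ := by exact_mod_cast hlt
    linarith

/-! ### The axis -/

lemma height_axis (x : ℝ) : height (x, 0) = Real.cos (2 * x) := by
  have h1 := Real.cos_le_one (2 * x)
  have h2 := Real.neg_one_le_cos (2 * x)
  simp only [height, mul_zero, Real.cos_zero]
  rw [abs_of_nonneg (by linarith), abs_of_nonpos (by linarith)]; ring

lemma mem_poles_axis (x : ℝ) : (x, 0) ∈ poles ↔ Real.cos x = 0 := by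
  rw [poles, Set.mem_ofPred_eq, height_axis, Real.cos_two_mul]
  constructor
  · intro h
    have : Real.cos x ^ 2 = 0 := by linarith
    exact pow_eq_zero_iff two_ne_zero |>.1 this
  · intro h; rw [h]; norm_num

lemma planar_axis (lam x : ℝ) : planar lam (x, 0) = (lam * Real.tan x, 0) := by
  have h0 : foldTwo 0 = 0 := by simp [foldTwo]
  have hs : ∀ t : ℝ, Real.sin |t| / |t| * t = Real.sin t := by
    intro t
    rcases lt_trichotomy t 0 with h | h | h
    · rw [abs_of_neg h, Real.sin_neg, neg_div_neg_eq, div_mul_cancel₀ _ h.ne]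
    · simp [h]
    · rw [abs_of_pos h]; field_simp
  have hf : Real.sin (foldTwo x) = Real.sin (2 * x) :=
    Real.sin_arcsin (Real.neg_one_le_sin _) (Real.sin_le_one _)
  simp only [planar, height_axis, h0, horiz, euc, Prod.smul_mk, smul_eq_mul, mul_zero]
  rw [norm_eq_max]
  simp only [abs_zero, ne_eq, OfNat.ofNat_ne_zero, not_false_eq_true, zero_pow, add_zero,
    Real.sqrt_sq_eq_abs]
  rw [max_eq_left (abs_nonneg _), hs, hf, Real.sin_two_mul, Real.cos_two_mul,
    Real.tan_eq_sin_div_cos]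
  congr 1
  rcases eq_or_ne (Real.cos x) 0 with h | h
  · simp [h]
  · rw [show 1 + (2 * Real.cos x ^ 2 - 1) = 2 * Real.cos x ^ 2 by ring]
    field_simp

lemma iterate_planar_axis (lam : ℝ) (k : ℕ) (x : ℝ) :
    (planar lam)^[k] (x, 0) = ((fun t => lam * Real.tan t)^[k] x, 0) := by
  induction k generalizing x with
  | zero => rfl
  | succ k ih => rw [Function.iterate_succ_apply, Function.iterate_succ_apply, planar_axis, ih]

/-- If each compact set is mapped across the next one, then some orbit visits them in turn. -/
lemma exists_orbit_of_subset_image {X : Type*} [TopologicalSpace X] [T2Space X] {f : X → X}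
    {K : ℕ → Set X} (hK : ∀ n, IsCompact (K n)) (hne : ∀ n, (K n).Nonempty)
    (hf : ∀ n, ContinuousOn f (K n)) (hsub : ∀ n, K (n + 1) ⊆ f '' K n) :
    ∃ x, ∀ n, f^[n] x ∈ K n := by
  -- Finite itineraries through `K m, …, K (m + n)`. The induction strips off the first set, so the
  -- starting index has to vary.
  have key : ∀ n m, IsCompact {x | ∀ i ≤ n, f^[i] x ∈ K (m + i)} ∧
      {x | ∀ i ≤ n, f^[i] x ∈ K (m + i)}.Nonempty := by
    intro n
    induction n with
    | zero =>
      intro m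
      have : {x | ∀ i ≤ 0, f^[i] x ∈ K (m + i)} = K m := by ext x; simp
      rw [this]
      exact ⟨hK m, hne m⟩
    | succ n ih =>
      intro m
      have : {x | ∀ i ≤ n + 1, f^[i] x ∈ K (m + i)}
          = K m ∩ f ⁻¹' {x | ∀ i ≤ n, f^[i] x ∈ K (m + 1 + i)} := by
        ext x
        constructor
        · intro h
          refine ⟨by simpa using h 0 (by omega), fun i hi => ?_⟩
          have := h (i + 1) (by omega)
          rw [Function.iterate_succ_apply] at this
          rwa [show m + 1 + i = m + (i + 1) by ring]
        · rintro ⟨h1, h2⟩ i hi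
          cases i with
          | zero => simpa using h1
          | succ i =>
            have := h2 i (by omega)
            rw [Function.iterate_succ_apply]
            rwa [show m + (i + 1) = m + 1 + i by ring]
      rw [this]
      obtain ⟨hc, y, hy⟩ := ih (m + 1)
      constructor
      · exact (hK m).of_isClosed_subset
          ((hf m).preimage_isClosed_of_isClosed (hK m).isClosed hc.isClosed)
          Set.inter_subset_left
      · obtain ⟨x, hx, rfl⟩ := hsub m (by simpa using hy 0 (by omega))
        exact ⟨x, hx, hy⟩
  have h := IsCompact.nonempty_iInter_of_sequence_nonempty_isCompact_isClosed
    (fun n => {x | ∀ i ≤ n, f^[i] x ∈ K (0 + i)})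
    (fun n x hx i hi => hx i (by omega)) (fun n => (key n 0).2) (key 0 0).1
    (fun n => (key n 0).1.isClosed)
  obtain ⟨x, hx⟩ := h
  refine ⟨x, fun n => ?_⟩
  rw [Set.mem_iInter] at hx
  simpa using hx n n le_rfl

/-- On the x-axis the map is `lam * tan`, and it sends the interval `K n` starting at nπ across `K
(n + 1)`. An orbit visiting these intervals in turn escapes. -/
theorem planarEsc_nonempty {lam : ℝ} (hlam : 0 < lam) : (planarEsc lam).Nonempty := by
  have hpi := Real.pi_pos
  -- The right end of `K n` is mapped to (n + 2)π, which exceeds the right end of `K (n + 1)`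
  -- because b < π/2.
  set b : ℕ → ℝ := fun n => Real.arctan ((n + 2) * Real.pi / lam)
  have hb0 : ∀ n, 0 ≤ b n := fun n => Real.arctan_nonneg.2 (by positivity)
  have hb1 : ∀ n, b n < Real.pi / 2 := fun n => Real.arctan_lt_pi_div_two _
  set K : ℕ → Set ℝ := fun n => Set.Icc (n * Real.pi) (n * Real.pi + b n)
  have hcos : ∀ n, ∀ x ∈ K n, Real.cos x ≠ 0 := by
    rintro n x ⟨h1, h2⟩ h
    have : Real.cos (x - n * Real.pi) = 0 := by rw [Real.cos_sub_nat_mul_pi, h, mul_zero]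
    have h3 : 0 < Real.cos (x - n * Real.pi) :=
      Real.cos_pos_of_mem_Ioo ⟨by linarith, by linarith [hb1 n]⟩
    linarith
  obtain ⟨x, hx⟩ := exists_orbit_of_subset_image (f := fun t => lam * Real.tan t) (K := K)
    (fun n => isCompact_Icc) (fun n => Set.nonempty_Icc.2 (by linarith [hb0 n]))
    (fun n t ht => ((Real.continuousAt_tan.2 (hcos n t ht)).const_mul lam).continuousWithinAt)
    (fun n y hy => by
      obtain ⟨h1, h2⟩ := hy
      push_cast at h1 h2
      have hy0 : 0 ≤ y := le_trans (by positivity) h1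
      refine ⟨n * Real.pi + Real.arctan (y / lam), ⟨?_, ?_⟩, ?_⟩
      · linarith [Real.arctan_nonneg.2 (div_nonneg hy0 hlam.le)]
      · have : Real.arctan (y / lam) ≤ b n := by
          refine Real.arctan_mono ?_
          gcongr
          have := hb1 (n + 1)
          linarith
        linarith
      · rw [add_comm]
        simp only [Real.tan_add_nat_mul_pi, Real.tan_arctan]
        field_simp)
  refine ⟨(x, 0), ?_, ?_⟩
  · rintro ⟨k, hk⟩
    rw [iterate_planar_axis, mem_poles_axis] at hk
    exact hcos k _ (hx k) hk
  · refine tendsto_atTop_mono (fun k => ?_)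
      (tendsto_natCast_atTop_atTop.atTop_mul_const hpi)
    rw [iterate_planar_axis, norm_eq_max]
    exact (hx k).1.trans ((le_abs_self _).trans (le_max_left _ _))

lemma exists_mem_planarEsc_norm_ge {lam : ℝ} (hlam : 0 < lam) (R : ℝ) :
    ∃ q ∈ planarEsc lam, R ≤ ‖q‖ := by
  obtain ⟨p, hp⟩ := planarEsc_nonempty hlam
  obtain ⟨k, hk⟩ := (hp.2.eventually_ge_atTop R).exists
  refine ⟨(planar lam)^[k] p, ?_, hk⟩
  clear hk
  induction k generalizing p with
  | zero => exact hp
  | succ k ih =>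
    rw [Function.iterate_succ_apply]
    exact ih _ ((mem_planarEsc_iff (notMem_poles_of_mem_planarEsc hp)).1 hp)

/-- The escaping set is unbounded, so it has preimages arbitrarily close to each pole, and these
escape too. -/
theorem poles_subset_closure {lam : ℝ} (hlam : 0 < lam) : poles ⊆ closure (planarEsc lam) := by
  intro p hp
  refine closure_mono ?_
    (pole_mem_closure_preimage hlam hp (exists_mem_planarEsc_norm_ge hlam))
  rintro q ⟨hq, hq'⟩
  exact (mem_planarEsc_iff hq).2 hq'

theorem prepoles_subset_closure {lam : ℝ} (hlam : 0 < lam) :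
    prepoles lam ⊆ closure (planarEsc lam) := by
  rintro p ⟨k, hk⟩
  induction k generalizing p with
  | zero => exact poles_subset_closure hlam hk
  | succ k ih =>
    by_cases hp : p ∈ poles
    · exact poles_subset_closure hlam hp
    · rw [Function.iterate_succ_apply] at hk
      exact closure_planarEsc_backward hlam hp (ih hk)

/-! ### Expansion along escaping orbits -/

/-- With countable fibres this lets a connected set be recognised as a point from its image, without
injectivity of the iterates. -/
lemma subsingleton_of_countable {L : Set (ℝ × ℝ)} (hL : IsPreconnected L) (hc : L.Countable) :
    L.Subsingleton := hc.isTotallyDisconnected L subset_rfl hL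

lemma countable_preimage_iterate {lam : ℝ} (hlam : 0 < lam) (k : ℕ) {S : Set (ℝ × ℝ)}
    (hS : S.Countable) : {p | (planar lam)^[k] p ∈ S}.Countable := by
  induction k generalizing S with
  | zero => exact hS
  | succ k ih =>
    have : {p | planar lam p ∈ S}.Countable := by
      have h : {p | planar lam p ∈ S} = ⋃ q ∈ S, {p | planar lam p = q} := by
        ext p; simp
      rw [h]
      exact hS.biUnion fun q _ => countable_fibre hlam q
    refine (ih this).mono fun p hp => ?_
    simpa only [Set.mem_ofPred_eq, Function.iterate_succ_apply'] using hp

lemma continuousAt_iterate {lam : ℝ} {p : ℝ × ℝ} (hp : p ∉ prepoles lam) (k : ℕ) :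
    ContinuousAt (planar lam)^[k] p := by
  induction k with
  | zero => exact continuousAt_id
  | succ k ih =>
    rw [Function.iterate_succ']
    exact (continuousAt_planar lam fun h => hp ⟨k, h⟩).comp ih

/-- On a connected set where the tangent map is large it is uniformly expanding. -/
lemma expand_of_large {lam R : ℝ} (hlam : 0 < lam) (hR : lam < R) (h8 : 8 * lam ≤ R ^ 2)
    {S : Set (ℝ × ℝ)} (hS : IsPreconnected S) (hlarge : ∀ p ∈ S, R ≤ ‖planar lam p‖)
    {p q : ℝ × ℝ} (hp : p ∈ S) (hq : q ∈ S) :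
    ‖p - q‖ ≤ ‖planar lam p - planar lam q‖ / 2 := by
  have hpi := Real.pi_pos
  -- Even squares, borders included, have images of Euclidean norm at most `lam < R`, so S lies in
  -- the interiors of odd squares.
  have hodd : ∀ p ∈ S, ∀ k l v, ‖v‖ ≤ Real.pi / 4 → p = chart k l v →
      Odd (k + l) ∧ ‖v‖ < Real.pi / 4 := by
    rintro p hp k l v hv rfl
    have h1 := (hlarge _ hp).trans (norm_le_euc _)
    have hodd' : ∀ k' l' : ℤ, ∀ v' : ℝ × ℝ, ‖v'‖ ≤ Real.pi / 4 → chart k l v = chart k' l' v' →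
        Odd (k' + l') := by
      intro k' l' v' hv' he
      by_contra hne
      rw [Int.not_odd_iff_even] at hne
      rw [he, euc_planar_even hlam hne hv'] at h1
      nlinarith [tan_norm_le_one hv']
    have ho := hodd' k l v hv rfl
    refine ⟨ho, lt_of_le_of_ne hv fun he => ?_⟩
    obtain ⟨k', l', v', h2, h3, h4⟩ := exists_square_border k l he
    have := (hodd' k' l' v' h3 h4).sub_odd ho
    exact (Int.not_odd_iff_even.2 this) h2
  -- Here `π` is a coordinate function, not the number. A value at an odd multiple of π/4 would put
  -- the point on an edge, so by connectedness S stays in one square, with a single inverse branch.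
  have havoid : ∀ (π : ℝ × ℝ → ℝ), Continuous π → (∀ p, |π p| ≤ ‖p‖) →
      (∀ k l v, ∃ j : ℤ, π (chart k l v) = chartOne j (π v)) →
      round (π p / (Real.pi / 2)) = round (π q / (Real.pi / 2)) := by
    intro π hπ hn hch
    have hS' : IsPreconnected ((fun p => π p / (Real.pi / 2)) '' S) :=
      hS.image _ (by fun_prop)
    refine IsPreconnected.round_eq_of_avoid hS' ?_ ⟨p, hp, rfl⟩ ⟨q, hq, rfl⟩
    rintro n ⟨w, hw, hwn⟩
    obtain ⟨k, l, v, hv, hwv, -, -⟩ := exists_chart w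
    have hlt := (hn v).trans_lt (hodd w hw k l v hv hwv).2
    obtain ⟨j, hj⟩ := hch k l v
    rw [hwv] at hwn
    simp only [hj, chartOne] at hwn
    have h1 : sgn j * π v = (n - j + 1 / 2) * (Real.pi / 2) := by
      rw [div_eq_iff (by positivity)] at hwn; linarith
    have h2 : |sgn j * π v| < Real.pi / 4 := by rwa [abs_sgn_mul]
    rw [h1, abs_mul, abs_of_pos (by positivity : (0 : ℝ) < Real.pi / 2)] at h2
    have h3 : |((n - j : ℤ) : ℝ) + 1 / 2| < 1 / 2 := by
      push_cast
      by_contra! h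
      nlinarith
    rw [abs_lt] at h3
    have h4 : (-1 : ℝ) < ((n - j : ℤ) : ℝ) := by linarith [h3.1]
    have h5 : ((n - j : ℤ) : ℝ) < 0 := by linarith [h3.2]
    have h4' : (-1 : ℤ) < n - j := by exact_mod_cast h4
    have h5' : n - j < (0 : ℤ) := by exact_mod_cast h5
    omega
  have hk := havoid Prod.fst continuous_fst (fun p => norm_fst_le p) (fun k l v => ⟨k, rfl⟩)
  have hl := havoid Prod.snd continuous_snd (fun p => norm_snd_le p) (fun k l v => ⟨l, rfl⟩)
  obtain ⟨k, l, v, hv, hpv, hk1, hl1⟩ := exists_chart p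
  obtain ⟨k', l', w, hw, hqw, hk2, hl2⟩ := exists_chart q
  obtain rfl : k = k' := by rw [hk1, hk2, hk]
  obtain rfl : l = l' := by rw [hl1, hl2, hl]
  have ho := (hodd p hp k l v hv hpv).1
  have := invPole_contract hlam (hlam.trans hR) h8 (hlarge p hp) (hlarge q hq)
  rwa [hpv, hqw, invPole_planar hlam ho hv, invPole_planar hlam ho hw, ← norm_chart_sub k l,
    ← hpv, ← hqw] at this

/-- A connected set whose images stay bounded around an escaping orbit is a point. -/
theorem subsingleton_of_escaping {lam : ℝ} (hlam : 0 < lam) {L : Set (ℝ × ℝ)}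
    (hL : IsPreconnected L) (hpre : ∀ q ∈ L, q ∉ prepoles lam) {v : ℝ × ℝ} (hv : v ∈ L)
    (hesc : v ∈ planarEsc lam) {R : ℝ}
    (hR : ∀ k : ℕ, ∀ q ∈ L, ‖(planar lam)^[k] q - (planar lam)^[k] v‖ ≤ R) :
    L.Subsingleton := by
  -- Any N with `lam < N` and `8 * lam ≤ N ^ 2` would do.
  set N : ℝ := 8 * lam + 1
  have h8 : 8 * lam ≤ N ^ 2 := by nlinarith
  obtain ⟨K, hK⟩ := eventually_atTop.1 (hesc.2.eventually_ge_atTop (N + R))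
  have hlarge : ∀ k ≥ K, ∀ q ∈ L, N ≤ ‖(planar lam)^[k] q‖ := by
    intro k hk q hq
    have h1 := hK k hk
    have h2 := hR k q hq
    have h3 := norm_sub_norm_le ((planar lam)^[k] v) ((planar lam)^[k] q)
    rw [norm_sub_rev] at h3
    linarith
  have hstep : ∀ k ≥ K, ∀ q ∈ L, ‖(planar lam)^[k] q - (planar lam)^[k] v‖ ≤
      ‖(planar lam)^[k + 1] q - (planar lam)^[k + 1] v‖ / 2 := by
    intro k hk q hq
    have hS : IsPreconnected ((planar lam)^[k] '' L) :=
      hL.image _ fun q hq => (continuousAt_iterate (hpre q hq) k).continuousWithinAt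
    rw [Function.iterate_succ_apply', Function.iterate_succ_apply']
    refine expand_of_large hlam (by linarith : lam < N) h8 hS ?_ ⟨q, hq, rfl⟩ ⟨v, hv, rfl⟩
    rintro _ ⟨w, hw, rfl⟩
    rw [← Function.iterate_succ_apply' (planar lam)]
    exact hlarge (k + 1) (by omega) w hw
  -- Going j steps ahead halves the distance j times on the way back, while the distance at the far
  -- end is at most R.
  have hpow : ∀ q ∈ L, ∀ j : ℕ,
      ‖(planar lam)^[K] q - (planar lam)^[K] v‖ ≤ R * (1 / 2) ^ j := by
    intro q hq j
    have : ‖(planar lam)^[K] q - (planar lam)^[K] v‖ ≤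
        ‖(planar lam)^[K + j] q - (planar lam)^[K + j] v‖ * (1 / 2) ^ j := by
      induction j with
      | zero => simp
      | succ j ih =>
        refine ih.trans ?_
        have := mul_le_mul_of_nonneg_right (hstep (K + j) (by omega) q hq)
          (by positivity : (0 : ℝ) ≤ (1 / 2) ^ j)
        rw [pow_succ]
        rw [show K + (j + 1) = K + j + 1 by ring]
        linarith
    exact this.trans (mul_le_mul_of_nonneg_right (hR _ q hq) (by positivity))
  have heq : ∀ q ∈ L, (planar lam)^[K] q = (planar lam)^[K] v := by
    intro q hq
    have ht : Tendsto (fun j : ℕ => R * (1 / 2 : ℝ) ^ j) atTop (𝓝 (R * 0)) :=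
      (tendsto_pow_atTop_nhds_zero_of_lt_one (by norm_num) (by norm_num)).const_mul R
    have := ge_of_tendsto' ht (hpow q hq)
    rw [mul_zero] at this
    exact sub_eq_zero.1 (norm_eq_zero.1 (le_antisymm this (norm_nonneg _)))
  exact subsingleton_of_countable hL
    ((countable_preimage_iterate hlam K (Set.countable_singleton _)).mono heq)

/-! ### The case `lam < 1` -/

/-- The union of the diagonal lines `x ± y ∈ π ℤ`. -/
def diagonals : Set (ℝ × ℝ) := {p | Real.cos (2 * p.1) = Real.cos (2 * p.2)}

lemma mem_diagonals_iff (p : ℝ × ℝ) :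
    p ∈ diagonals ↔ Real.sin (p.1 + p.2) = 0 ∨ Real.sin (p.1 - p.2) = 0 := by
  have h : Real.cos (2 * p.1) - Real.cos (2 * p.2)
      = -2 * (Real.sin (p.1 + p.2) * Real.sin (p.1 - p.2)) := by
    rw [Real.cos_sub_cos]
    rw [show (2 * p.1 + 2 * p.2) / 2 = p.1 + p.2 by ring,
      show (2 * p.1 - 2 * p.2) / 2 = p.1 - p.2 by ring]
    ring
  rw [diagonals, Set.mem_ofPred_eq, ← sub_eq_zero, h, mul_eq_zero, mul_eq_zero]
  norm_num

lemma diagonals_of_abs_eq {p : ℝ × ℝ} (h : |p.1| = |p.2|) : p ∈ diagonals := by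
  rw [diagonals, Set.mem_ofPred_eq, ← Real.cos_abs, abs_mul, h, ← abs_mul, Real.cos_abs]

/-- On these lines the height is |cos 2y| ≥ 0. -/
lemma notMem_poles_of_diagonals {p : ℝ × ℝ} (h : p ∈ diagonals) : p ∉ poles := by
  have h' : Real.cos (2 * p.1) = Real.cos (2 * p.2) := h
  rw [poles, Set.mem_ofPred_eq, height, h', sub_self, abs_zero]
  have := abs_nonneg (Real.cos (2 * p.2) + Real.cos (2 * p.2))
  intro h0
  linarith

lemma abs_foldTwo_eq {p : ℝ × ℝ} (h : p ∈ diagonals) : |foldTwo p.1| = |foldTwo p.2| := by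
  have h' : Real.cos (2 * p.1) = Real.cos (2 * p.2) := h
  have h2 : Real.sin (2 * p.1) ^ 2 = Real.sin (2 * p.2) ^ 2 := by
    rw [Real.sin_sq, Real.sin_sq, h']
  rcases sq_eq_sq_iff_eq_or_eq_neg.1 h2 with h3 | h3 <;> simp [foldTwo, h3, Real.arcsin_neg]

lemma planar_diagonals (lam : ℝ) {p : ℝ × ℝ} (h : p ∈ diagonals) :
    |(planar lam p).1| = |(planar lam p).2| := by
  simp only [planar, horiz, Prod.smul_mk, smul_eq_mul, abs_mul, abs_foldTwo_eq h]

lemma norm_mul_self_of_abs_eq {q : ℝ × ℝ} (h : |q.1| = |q.2|) : euc q ^ 2 = 2 * ‖q‖ ^ 2 := by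
  rw [euc_sq, norm_eq_max, h, max_self, sq_abs, ← sq_abs q.1, h, sq_abs]; ring

/-- Nonnegative height excludes the interiors of odd squares, so the Euclidean norm of the image is
at most `lam`. The image satisfies |x| = |y|, hence its max-norm is at most lam/√2 < π/4. -/
lemma norm_planar_diagonals_le {lam : ℝ} (hlam : 0 < lam) (h1 : lam < 1) {p : ℝ × ℝ}
    (h : p ∈ diagonals) : ‖planar lam p‖ ≤ Real.pi / 4 := by
  have hE : euc (planar lam p) ≤ lam := by
    obtain ⟨k, l, v, hv, rfl, -, -⟩ := exists_chart p
    rcases Int.even_or_odd (k + l) with he | ho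
    · rw [euc_planar_even hlam he hv]
      nlinarith [tan_norm_le_one hv]
    · have hh : 0 ≤ height (chart k l v) := by
        have h' : Real.cos (2 * (chart k l v).1) = Real.cos (2 * (chart k l v).2) := h
        rw [height, h', sub_self, abs_zero, sub_zero]; positivity
      rw [height_chart k l hv, sgn_odd ho] at hh
      have hpi := Real.pi_pos
      have hm : ‖v‖ = Real.pi / 4 := by
        by_contra hne
        have hlt := lt_of_le_of_ne hv hne
        have := Real.cos_pos_of_mem_Ioo (x := 2 * ‖v‖)
          ⟨by linarith [norm_nonneg v], by linarith⟩
        linarith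
      rw [euc_planar_odd hlam ho hv, hm, Real.tan_pi_div_four, div_one]
  have h2 := norm_mul_self_of_abs_eq (planar_diagonals lam h)
  have h3 := euc_nonneg (planar lam p)
  have hpi := Real.pi_gt_three
  apply le_of_sq_le_sq _ (by positivity)
  nlinarith

/-- For max-norm m the image has max-norm lam tan m / √2, and tan m ≤ m / cos(π/4) = √2 m. -/
lemma norm_planar_le_of_abs_eq {lam : ℝ} (hlam : 0 < lam) {p : ℝ × ℝ}
    (h : |p.1| = |p.2|) (hp : ‖p‖ ≤ Real.pi / 4) : ‖planar lam p‖ ≤ lam * ‖p‖ := by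
  have hpi := Real.pi_pos
  have h0 := norm_nonneg p
  have hE : euc (planar lam p) = lam * Real.tan ‖p‖ := by
    have := euc_planar_even hlam (k := 0) (l := 0) (by simp) hp
    have hc : chart 0 0 p = p := by simp [chart, chartOne, sgn]
    rwa [hc] at this
  have h2 := norm_mul_self_of_abs_eq (planar_diagonals lam (diagonals_of_abs_eq h))
  rw [hE] at h2
  have hcos : Real.cos (Real.pi / 4) ≤ Real.cos ‖p‖ :=
    Real.cos_le_cos_of_nonneg_of_le_pi h0 (by linarith) hp
  rw [Real.cos_pi_div_four] at hcos
  have hs2 : √2 ^ 2 = (2 : ℝ) := Real.sq_sqrt (by norm_num)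
  have hc2 : 1 / 2 ≤ Real.cos ‖p‖ ^ 2 := by
    have := pow_le_pow_left₀ (by positivity) hcos 2
    rw [div_pow, hs2] at this
    linarith
  have ht : Real.tan ‖p‖ ^ 2 ≤ 2 * ‖p‖ ^ 2 := by
    rw [Real.tan_eq_sin_div_cos, div_pow, div_le_iff₀ (by linarith)]
    have hs : Real.sin ‖p‖ ^ 2 ≤ ‖p‖ ^ 2 :=
      pow_le_pow_left₀ (Real.sin_nonneg_of_nonneg_of_le_pi h0 (by linarith)) (Real.sin_le h0) 2
    nlinarith
  apply le_of_sq_le_sq _ (by positivity)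
  have := mul_le_mul_of_nonneg_left ht (sq_nonneg lam)
  nlinarith

/-- For `lam < 1` the origin attracts a neighbourhood. -/
lemma exists_attracted_ball {lam : ℝ} (hlam : 0 < lam) (h1 : lam < 1) :
    ∃ δ > 0, ∀ p : ℝ × ℝ, ‖p‖ < δ → ‖planar lam p‖ < δ := by
  have hpi := Real.pi_pos
  -- Below arccos lam one has lam ≤ cos m, so lam tan m ≤ sin m ≤ m; the bound π/4 keeps p in the
  -- central square.
  refine ⟨min (Real.arccos lam) (Real.pi / 4), lt_min (Real.arccos_pos.2 h1) (by positivity),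
    fun p hp => lt_of_le_of_lt ?_ hp⟩
  have ha := (hp.trans_le (min_le_left _ _)).le
  have hp4 := (hp.trans_le (min_le_right _ _)).le
  have h0 := norm_nonneg p
  have hE := euc_planar_even hlam (k := 0) (l := 0) (by simp) hp4
  rw [show chart 0 0 p = p by simp [chart, chartOne, sgn]] at hE
  refine (norm_le_euc _).trans ?_
  have hcos : lam ≤ Real.cos ‖p‖ := by
    rw [← Real.cos_arccos (by linarith : -1 ≤ lam) h1.le]
    exact Real.cos_le_cos_of_nonneg_of_le_pi h0 (Real.arccos_le_pi _) ha
  have hs := Real.sin_le h0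
  have hs0 := Real.sin_nonneg_of_nonneg_of_le_pi h0 (by linarith)
  rw [hE, Real.tan_eq_sin_div_cos, ← mul_div_assoc, div_le_iff₀ (by linarith)]
  nlinarith

/-- After one step the orbit stays on |x| = |y| and shrinks by the factor `lam`, so it enters the
attracted ball. It would remain in the closed escaping set, which that ball misses. -/
lemma diagonals_disjoint_closure {lam : ℝ} (hlam : 0 < lam) (h1 : lam < 1) {p : ℝ × ℝ}
    (hp : p ∈ diagonals) : p ∉ closure (planarEsc lam) := by
  obtain ⟨δ, hδ, hU⟩ := exists_attracted_ball hlam h1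
  have hUI : ∀ p : ℝ × ℝ, ‖p‖ < δ → p ∉ closure (planarEsc lam) := by
    intro p hp hc
    obtain ⟨q, hq, hqI⟩ := mem_closure_iff.1 hc {q | ‖q‖ < δ}
      (isOpen_lt continuous_norm continuous_const) hp
    have hb : ∀ k : ℕ, ‖(planar lam)^[k] q‖ < δ := by
      intro k
      induction k with
      | zero => exact hq
      | succ k ih => rw [Function.iterate_succ_apply']; exact hU _ ih
    obtain ⟨k, hk⟩ := (hqI.2.eventually_ge_atTop δ).exists
    exact absurd (hb k) (not_lt.2 hk)
  intro hc
  set C := closure (planarEsc lam)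
  have horbit : ∀ n : ℕ, (planar lam)^[n] (planar lam p) ∈ C ∧
      |((planar lam)^[n] (planar lam p)).1| = |((planar lam)^[n] (planar lam p)).2| ∧
      ‖(planar lam)^[n] (planar lam p)‖ ≤ lam ^ n * (Real.pi / 4) := by
    intro n
    induction n with
    | zero =>
      exact ⟨closure_planarEsc_forward (notMem_poles_of_diagonals hp) hc,
        planar_diagonals lam hp, by simpa using norm_planar_diagonals_le hlam h1 hp⟩
    | succ n ih =>
      obtain ⟨i1, i2, i3⟩ := ih
      have hd := diagonals_of_abs_eq i2
      have hpi := Real.pi_pos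
      rw [Function.iterate_succ_apply']
      refine ⟨closure_planarEsc_forward (notMem_poles_of_diagonals hd) i1,
        planar_diagonals lam hd, ?_⟩
      have hle : lam ^ n ≤ 1 := pow_le_one₀ hlam.le h1.le
      refine (norm_planar_le_of_abs_eq hlam i2 (i3.trans (by nlinarith))).trans ?_
      rw [pow_succ]
      nlinarith
  have ht : Tendsto (fun n : ℕ => lam ^ n * (Real.pi / 4)) atTop (𝓝 (0 * (Real.pi / 4))) :=
    (tendsto_pow_atTop_nhds_zero_of_lt_one hlam.le h1).mul_const _
  rw [zero_mul] at ht
  obtain ⟨n, hn⟩ := (ht.eventually_lt_const hδ).exists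
  exact hUI _ ((horbit n).2.2.trans_lt hn) (horbit n).1

/-- Both x + y and x - y avoid πℤ, so each varies by less than π; the coordinates are half their sum
and half their difference. -/
lemma norm_sub_le_of_avoid_diagonals {S : Set (ℝ × ℝ)} (hS : IsPreconnected S)
    (h : ∀ p ∈ S, p ∉ diagonals) {p q : ℝ × ℝ} (hp : p ∈ S) (hq : q ∈ S) :
    ‖p - q‖ ≤ Real.pi := by
  have key : ∀ (f : ℝ × ℝ → ℝ), Continuous f → (∀ p, Real.sin (f p) = 0 → p ∈ diagonals) →
      |f p - f q| < Real.pi := by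
    intro f hf hd
    refine IsPreconnected.abs_sub_lt_of_avoid (hS.image f hf.continuousOn) (d := 0) Real.pi_pos ?_
      ⟨p, hp, rfl⟩ ⟨q, hq, rfl⟩
    rintro n ⟨w, hw, hn⟩
    refine h w hw (hd w ?_)
    rw [hn, add_zero, Real.sin_int_mul_pi]
  have k1 := key (fun p => p.1 + p.2) (by fun_prop) fun p hp => (mem_diagonals_iff p).2 (Or.inl hp)
  have k2 := key (fun p => p.1 - p.2) (by fun_prop) fun p hp => (mem_diagonals_iff p).2 (Or.inr hp)
  rw [abs_lt] at k1 k2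
  rw [norm_eq_max]
  simp only [Prod.fst_sub, Prod.snd_sub]
  refine max_le (abs_le.2 ⟨?_, ?_⟩) (abs_le.2 ⟨?_, ?_⟩) <;> linarith

lemma one_add_height_nonneg (p : ℝ × ℝ) : 0 ≤ 1 + height p := by
  have h1 := Real.cos_le_one (2 * p.1)
  have h2 := Real.neg_one_le_cos (2 * p.1)
  have h3 := Real.cos_le_one (2 * p.2)
  have h4 := Real.neg_one_le_cos (2 * p.2)
  rw [height]
  have := abs_nonneg (Real.cos (2 * p.1) + Real.cos (2 * p.2))
  have : |Real.cos (2 * p.1) - Real.cos (2 * p.2)| ≤ 2 := abs_le.2 ⟨by linarith, by linarith⟩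
  linarith

/-- The image of the hemisphere map lies on the unit sphere; the left side is the squared length of
its horizontal part. -/
lemma sin_norm_foldTwo_sq (p : ℝ × ℝ) :
    Real.sin ‖((foldTwo p.1, foldTwo p.2) : ℝ × ℝ)‖ ^ 2 = 1 - height p ^ 2 := by
  obtain ⟨k, l, v, hv, rfl, -, -⟩ := exists_chart p
  have h1 : |v.1| ≤ Real.pi / 4 := (le_max_left _ _).trans (norm_eq_max v ▸ hv)
  have h2 : |v.2| ≤ Real.pi / 4 := (le_max_right _ _).trans (norm_eq_max v ▸ hv)
  rw [height_chart k l hv]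
  simp only [chart]
  rw [foldTwo_chartOne k h1, foldTwo_chartOne l h2]
  have h : ((2 * v.1, 2 * v.2) : ℝ × ℝ) = (2 : ℝ) • v := rfl
  rw [h, norm_smul, Real.sin_sq, mul_pow, pow_two (sgn _), sgn_mul_self]
  norm_num

lemma abs_height_le_one (p : ℝ × ℝ) : |height p| ≤ 1 := by
  rw [← sq_le_one_iff_abs_le_one]
  nlinarith [sin_norm_foldTwo_sq p, sq_nonneg (Real.sin ‖((foldTwo p.1, foldTwo p.2) : ℝ × ℝ)‖)]

/-- A connected subset of the closed escaping set which contains a pole is a point. -/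
lemma subsingleton_of_pole {lam : ℝ} (hlam : 0 < lam) (h1 : lam < 1) {L : Set (ℝ × ℝ)}
    (hL : IsPreconnected L) (hLC : L ⊆ closure (planarEsc lam)) {P : ℝ × ℝ} (hP : P ∈ L)
    (hPp : P ∈ poles) : L.Subsingleton := by
  refine subsingleton_of_countable hL (countable_poles.mono ?_)
  intro q hq
  by_contra hqp
  have hpi := Real.pi_pos
  set w : ℝ × ℝ → ℝ × ℝ := fun p => horiz (foldTwo p.1, foldTwo p.2)
  have hw : Continuous w := by
    have h3 := continuous_horiz
    have h4 := continuous_foldTwo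
    fun_prop
  have hh := continuous_height
  -- Off the poles the ℓ¹-norm of `planar lam p` is `N p / (1 + height p)`. Cleared of the
  -- denominator, comparisons with mπ remain continuous at the poles.
  set N : ℝ × ℝ → ℝ := fun p => lam * (|(w p).1| + |(w p).2|)
  have hN : Continuous N := by fun_prop
  have hwsq : ∀ p, 1 - height p ^ 2 ≤ (|(w p).1| + |(w p).2|) ^ 2 := by
    intro p
    rw [← sin_norm_foldTwo_sq, ← sq_abs (Real.sin _), ← euc_horiz, euc_sq]
    have := abs_nonneg (w p).1
    have := abs_nonneg (w p).2
    change (w p).1 ^ 2 + (w p).2 ^ 2 ≤ _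
    rw [← sq_abs (w p).1, ← sq_abs (w p).2]
    nlinarith [mul_nonneg (abs_nonneg (w p).1) (abs_nonneg (w p).2)]
  have hqpos : 0 < 1 + height q := lt_of_le_of_ne (one_add_height_nonneg q) (Ne.symm hqp)
  -- The ℓ¹-norm of the image of q is below mπ, whereas it is infinite at the pole P.
  obtain ⟨m, hm⟩ := exists_nat_gt (N q / (1 + height q) / Real.pi)
  rw [div_lt_iff₀ hpi, div_lt_iff₀ hqpos] at hm
  -- At a pole the first inequality reads 0 < 0, so the second set is added to cover the poles. Off
  -- the poles it is contained in the first, by `hwsq`.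
  set U : Set (ℝ × ℝ) := {p | m * Real.pi * (1 + height p) < N p} ∪
    {p | (m * Real.pi) ^ 2 * (1 + height p) < lam ^ 2 * (1 - height p)}
  set V : Set (ℝ × ℝ) := {p | N p < m * Real.pi * (1 + height p)}
  have hU : IsOpen U := (isOpen_lt (by fun_prop) hN).union (isOpen_lt (by fun_prop) (by fun_prop))
  have hV : IsOpen V := isOpen_lt hN (by fun_prop)
  have hPh : 1 + height P = 0 := hPp
  have hcov : L ⊆ U ∪ V := by
    intro p hp
    rcases lt_trichotomy (N p) (m * Real.pi * (1 + height p)) with h | h | h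
    · exact Or.inr h
    · by_cases hpp : 1 + height p = 0
      · refine Or.inl (Or.inr ?_)
        simp only [Set.mem_ofPred_eq, hpp, mul_zero]
        have : 0 < 1 - height p := by linarith
        positivity
      · exfalso
        have hpos : 0 < 1 + height p := lt_of_le_of_ne (one_add_height_nonneg p) (Ne.symm hpp)
        refine diagonals_disjoint_closure hlam h1 (p := planar lam p) ?_
          (closure_planarEsc_forward hpp (hLC hp))
        have hs : |(planar lam p).1| + |(planar lam p).2| = m * Real.pi := by
          have : planar lam p = (lam / (1 + height p)) • w p := rfl
          rw [this]
          simp only [Prod.smul_fst, Prod.smul_snd, smul_eq_mul, abs_mul]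
          rw [abs_of_pos (by positivity : 0 < lam / (1 + height p)), ← mul_add,
            div_mul_eq_mul_div, div_eq_iff hpp]
          exact h
        rw [mem_diagonals_iff]
        set x := (planar lam p).1
        set y := (planar lam p).2
        rcases abs_cases x with ⟨hx, -⟩ | ⟨hx, -⟩ <;> rcases abs_cases y with ⟨hy, -⟩ | ⟨hy, -⟩ <;>
          rw [hx, hy] at hs
        · left; rw [hs]; exact Real.sin_nat_mul_pi m
        · right; rw [sub_eq_add_neg, hs]; exact Real.sin_nat_mul_pi m
        · right; rw [show x - y = -(m * Real.pi) by linarith, Real.sin_neg, Real.sin_nat_mul_pi,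
            neg_zero]
        · left; rw [show x + y = -(m * Real.pi) by linarith, Real.sin_neg, Real.sin_nat_mul_pi,
            neg_zero]
    · exact Or.inl (Or.inl h)
  obtain ⟨p, -, hpU, hpV⟩ := hL U V hU hV hcov
    ⟨P, hP, Or.inr (by
      simp only [Set.mem_ofPred_eq, hPh, mul_zero]
      have : 0 < 1 - height P := by linarith
      positivity)⟩ ⟨q, hq, hm⟩
  have hpV' : N p < m * Real.pi * (1 + height p) := hpV
  rcases hpU with h | h
  · exact lt_asymm h hpV'
  · have h' : (m * Real.pi) ^ 2 * (1 + height p) < lam ^ 2 * (1 - height p) := h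
    have hN0 : 0 ≤ N p := by positivity
    have hpos : 0 < 1 + height p := by
      refine lt_of_le_of_ne (one_add_height_nonneg p) fun h0 => ?_
      rw [← h0, mul_zero] at hpV'
      linarith
    have h2 := pow_lt_pow_left₀ hpV' hN0 two_ne_zero
    have h3 := mul_le_mul_of_nonneg_left (hwsq p) (sq_nonneg lam)
    have h4 := mul_lt_mul_of_pos_right h' hpos
    have h5 : N p ^ 2 = lam ^ 2 * (|(w p).1| + |(w p).2|) ^ 2 := by simp only [N]; ring
    nlinarith

/-- If L meets no pole, its image is a point by induction, and L lies in a countable fibre. -/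
lemma subsingleton_of_prepole {lam : ℝ} (hlam : 0 < lam) (h1 : lam < 1) {L : Set (ℝ × ℝ)}
    (hL : IsPreconnected L) (hLC : L ⊆ closure (planarEsc lam)) {P : ℝ × ℝ} (hP : P ∈ L)
    (hPp : P ∈ prepoles lam) : L.Subsingleton := by
  obtain ⟨k, hk⟩ := hPp
  induction k generalizing L P with
  | zero => exact subsingleton_of_pole hlam h1 hL hLC hP hk
  | succ k ih =>
    by_cases h : ∃ q ∈ L, q ∈ poles
    · obtain ⟨q, hq, hqp⟩ := h
      exact subsingleton_of_pole hlam h1 hL hLC hq hqp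
    · push Not at h
      have hsub : (planar lam '' L).Subsingleton := by
        refine ih (hL.image _ fun q hq => (continuousAt_planar lam (h q hq)).continuousWithinAt)
          ?_ ⟨P, hP, rfl⟩ (by rwa [Function.iterate_succ_apply] at hk)
        rintro _ ⟨q, hq, rfl⟩
        exact closure_planarEsc_forward (h q hq) (hLC hq)
      exact subsingleton_of_countable hL ((countable_fibre hlam (planar lam P)).mono
        fun q hq => hsub ⟨q, hq, rfl⟩ ⟨P, hP, rfl⟩)

/-- For `lam < 1` connected subsets of the closed escaping set which contain a prepole or an
escaping point are points. -/
theorem subsingleton_of_lt_one {lam : ℝ} (hlam : 0 < lam) (h1 : lam < 1) {L : Set (ℝ × ℝ)}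
    (hL : IsPreconnected L) (hLC : L ⊆ closure (planarEsc lam)) {v : ℝ × ℝ} (hv : v ∈ L)
    (hv' : v ∈ prepoles lam ∪ planarEsc lam) : L.Subsingleton := by
  by_cases h : ∃ q ∈ L, q ∈ prepoles lam
  · obtain ⟨q, hq, hqp⟩ := h
    exact subsingleton_of_prepole hlam h1 hL hLC hq hqp
  push Not at h
  refine subsingleton_of_escaping hlam hL h hv (hv'.resolve_left (h v hv)) (R := Real.pi) ?_
  intro k q hq
  have hC : ∀ (k : ℕ), ∀ q ∈ L, (planar lam)^[k] q ∈ closure (planarEsc lam) := by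
    intro k q hq
    induction k with
    | zero => exact hLC hq
    | succ k ih =>
      rw [Function.iterate_succ_apply']
      exact closure_planarEsc_forward (fun hp => h q hq ⟨k, hp⟩) ih
  refine norm_sub_le_of_avoid_diagonals
    (hL.image _ fun q hq => (continuousAt_iterate (h q hq) k).continuousWithinAt) ?_
    ⟨q, hq, rfl⟩ ⟨v, hv, rfl⟩
  rintro _ ⟨w, hw, rfl⟩ hd
  exact diagonals_disjoint_closure hlam h1 hd (hC k w hw)

/-! ### The case `1 ≤ lam` -/

/-- From tan t - tan s = tan(t - s)(1 + tan t tan s) ≥ t - s. It ensures that longer intervals gain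
at least as much length per step as the initial one. -/
lemma tan_sub_self_mono {s t : ℝ} (hs : 0 ≤ s) (hst : s ≤ t) (ht : t < Real.pi / 2) :
    Real.tan s - s ≤ Real.tan t - t := by
  have hpi := Real.pi_pos
  have hcs : 0 < Real.cos s := Real.cos_pos_of_mem_Ioo ⟨by linarith, by linarith⟩
  have hct : 0 < Real.cos t := Real.cos_pos_of_mem_Ioo ⟨by linarith, by linarith⟩
  have h1 : Real.tan t - Real.tan s = Real.tan (t - s) * (1 + Real.tan t * Real.tan s) := by
    have hcd : Real.cos (t - s) ≠ 0 :=
      (Real.cos_pos_of_mem_Ioo ⟨by linarith, by linarith⟩).ne'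
    have : 1 + Real.tan t * Real.tan s = Real.cos (t - s) / (Real.cos t * Real.cos s) := by
      rw [Real.tan_eq_sin_div_cos, Real.tan_eq_sin_div_cos, Real.cos_sub]; field_simp
    rw [this, Real.tan_eq_sin_div_cos (t - s), Real.tan_eq_sin_div_cos, Real.tan_eq_sin_div_cos]
    have h2 := Real.sin_sub t s
    field_simp
    rw [h2]
  have h2 := Real.le_tan (x := t - s) (by linarith) (by linarith)
  have h3 := Real.tan_nonneg_of_nonneg_of_le_pi_div_two hs (by linarith)
  have h4 := Real.tan_nonneg_of_nonneg_of_le_pi_div_two (hs.trans hst) (by linarith)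
  nlinarith [mul_nonneg h3 h4]

/-- The tangent expands intervals which contain no pole. -/
lemma two_tan_half_le {a b : ℝ} (hab : |a - b| < Real.pi)
    (hcos : 0 < Real.cos a * Real.cos b) :
    2 * Real.tan (|a - b| / 2) ≤ |Real.tan a - Real.tan b| := by
  have hpi := Real.pi_pos
  set d := |a - b|
  have hd0 : 0 ≤ d := abs_nonneg _
  have ha : Real.cos a ≠ 0 := left_ne_zero_of_mul hcos.ne'
  have hb : Real.cos b ≠ 0 := right_ne_zero_of_mul hcos.ne'
  have hdiff : Real.tan a - Real.tan b = Real.sin (a - b) / (Real.cos a * Real.cos b) := by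
    rw [Real.tan_eq_sin_div_cos, Real.tan_eq_sin_div_cos, Real.sin_sub]; field_simp
  have hsin : |Real.sin (a - b)| = Real.sin d := by
    rw [Real.abs_sin_eq_sin_abs_of_abs_le_pi hab.le]
  -- At given distance d the product is largest for the symmetric pair ±d/2.
  have hprod : Real.cos a * Real.cos b ≤ Real.cos (d / 2) ^ 2 := by
    have h1 : 2 * (Real.cos a * Real.cos b) = Real.cos (a - b) + Real.cos (a + b) := by
      rw [Real.cos_sub, Real.cos_add]; ring
    have h2 : Real.cos (a - b) = 2 * Real.cos (d / 2) ^ 2 - 1 := by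
      rw [← Real.cos_abs, ← Real.cos_two_mul]; congr 1; ring
    linarith [Real.cos_le_one (a + b)]
  have hc : 0 < Real.cos (d / 2) := Real.cos_pos_of_mem_Ioo ⟨by linarith, by linarith⟩
  have hs : 0 ≤ Real.sin (d / 2) := Real.sin_nonneg_of_nonneg_of_le_pi (by linarith) (by linarith)
  rw [hdiff, abs_div, hsin, abs_of_pos hcos, le_div_iff₀ hcos]
  have h3 : Real.sin d = 2 * Real.sin (d / 2) * Real.cos (d / 2) := by
    rw [← Real.sin_two_mul]; congr 1; ring
  have h4 : 2 * Real.tan (d / 2) * Real.cos (d / 2) ^ 2 = Real.sin d := by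
    rw [Real.tan_eq_sin_div_cos, h3]; field_simp
  rw [← h4]
  refine mul_le_mul_of_nonneg_left hprod ?_
  have := Real.tan_nonneg_of_nonneg_of_le_pi_div_two (x := d / 2) (by linarith) (by linarith)
  linarith

/-- Otherwise all images of [a, b] stay in single branches of the tangent, so the endpoints remain
less than π apart. But their distance grows in each step by at least ε = 2 tan(d₀/2) - d₀ > 0, even
for `lam = 1`, where 0 is a neutral fixed point. -/
lemma exists_cos_iterate_eq_zero {lam : ℝ} (h1 : 1 ≤ lam) {a b : ℝ} (hab : a < b) :
    ∃ x ∈ Set.Icc a b, ∃ k : ℕ, Real.cos ((fun t => lam * Real.tan t)^[k] x) = 0 := by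
  by_contra! hno
  have hpi := Real.pi_pos
  set g : ℝ → ℝ := fun t => lam * Real.tan t
  have hconn : ∀ k, IsPreconnected (g^[k] '' Set.Icc a b) := by
    intro k
    refine isPreconnected_Icc.image _ ?_
    induction k with
    | zero => exact continuousOn_id
    | succ k ih =>
      intro x hx
      rw [Function.iterate_succ']
      have : ContinuousAt g (g^[k] x) :=
        (Real.continuousAt_tan.2 (hno x hx k)).const_mul lam
      exact this.comp_continuousWithinAt (ih x hx)
  have ha : a ∈ Set.Icc a b := ⟨le_rfl, hab.le⟩
  have hb : b ∈ Set.Icc a b := ⟨hab.le, le_rfl⟩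
  set d : ℕ → ℝ := fun k => |g^[k] b - g^[k] a|
  have hlt : ∀ k, d k < Real.pi := by
    intro k
    refine IsPreconnected.abs_sub_lt_of_avoid (hconn k) (d := Real.pi / 2) hpi ?_
      ⟨b, hb, rfl⟩ ⟨a, ha, rfl⟩
    rintro n ⟨x, hx, hn⟩
    refine hno x hx k (Real.cos_eq_zero_iff.2 ⟨n, ?_⟩)
    rw [hn]; ring
  have hcos : ∀ k, 0 < Real.cos (g^[k] b) * Real.cos (g^[k] a) := by
    intro k
    by_contra! hle
    have himg : IsPreconnected (Real.cos '' (g^[k] '' Set.Icc a b)) :=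
      (hconn k).image _ Real.continuous_cos.continuousOn
    have m1 : Real.cos (g^[k] b) ∈ Real.cos '' (g^[k] '' Set.Icc a b) := ⟨_, ⟨b, hb, rfl⟩, rfl⟩
    have m2 : Real.cos (g^[k] a) ∈ Real.cos '' (g^[k] '' Set.Icc a b) := ⟨_, ⟨a, ha, rfl⟩, rfl⟩
    have h0 : (0 : ℝ) ∈ Real.cos '' (g^[k] '' Set.Icc a b) := by
      rcases mul_nonpos_iff.1 hle with ⟨p1, p2⟩ | ⟨p1, p2⟩
      · exact himg.ordConnected.out m2 m1 ⟨p2, p1⟩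
      · exact himg.ordConnected.out m1 m2 ⟨p1, p2⟩
    obtain ⟨_, ⟨x, hx, rfl⟩, h⟩ := h0
    exact hno x hx k h
  have hstep : ∀ k, 2 * Real.tan (d k / 2) ≤ d (k + 1) := by
    intro k
    have h := two_tan_half_le (hlt k) (hcos k)
    have e : d (k + 1) = lam * |Real.tan (g^[k] b) - Real.tan (g^[k] a)| := by
      have : d (k + 1) = |lam * Real.tan (g^[k] b) - lam * Real.tan (g^[k] a)| := by
        simp only [d, Function.iterate_succ_apply']; rfl
      rw [this, ← mul_sub, abs_mul, abs_of_pos (by linarith : 0 < lam)]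
    rw [e]
    have := abs_nonneg (Real.tan (g^[k] b) - Real.tan (g^[k] a))
    exact h.trans (by nlinarith)
  have hd0 : 0 < d 0 := abs_pos.2 (sub_ne_zero.2 hab.ne')
  set ε := 2 * (Real.tan (d 0 / 2) - d 0 / 2)
  have hε : 0 < ε := by
    have := Real.lt_tan (x := d 0 / 2) (by linarith) (by linarith [hlt 0])
    simp only [ε]; linarith
  have hgrow : ∀ k : ℕ, d 0 + k * ε ≤ d k := by
    intro k
    induction k with
    | zero => simp
    | succ k ih =>
      have hk : (0 : ℝ) ≤ k * ε := by positivity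
      have := tan_sub_self_mono (s := d 0 / 2) (t := d k / 2) (by linarith) (by linarith)
        (by linarith [hlt k])
      have h2 := hstep k
      push_cast
      simp only [ε] at *
      linarith
  obtain ⟨n, hn⟩ := exists_nat_gt (Real.pi / ε)
  rw [div_lt_iff₀ hε] at hn
  linarith [hgrow n, hlt n]

/-! ### The grid and its pullbacks -/

/-- The grid of lines `x ∈ (π / 2) ℤ` and `y ∈ (π / 2) ℤ`. -/
def grid : Set (ℝ × ℝ) := {p | Real.sin (2 * p.1) = 0 ∨ Real.sin (2 * p.2) = 0}

lemma isClosed_grid : IsClosed grid :=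
  (isClosed_eq (by fun_prop) continuous_const).union (isClosed_eq (by fun_prop) continuous_const)

lemma zero_mem_grid : (0 : ℝ × ℝ) ∈ grid := by simp [grid]

lemma isPreconnected_grid : IsPreconnected grid := by
  refine isPreconnected_of_forall 0 fun p hp => ?_
  rcases hp with h | h
  · refine ⟨({p.1} ×ˢ Set.univ) ∪ (Set.univ ×ˢ {0}), ?_, by simp, by simp, ?_⟩
    · rintro ⟨x, y⟩ (hq | hq)
      · exact Or.inl (by rw [show x = p.1 from hq.1]; exact h)
      · exact Or.inr (by rw [show y = 0 from hq.2]; simp)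
    · exact IsPreconnected.union (p.1, 0) (by simp) (by simp)
        (isPreconnected_singleton.prod isPreconnected_univ)
        (isPreconnected_univ.prod isPreconnected_singleton)
  · refine ⟨(Set.univ ×ˢ {p.2}) ∪ ({0} ×ˢ Set.univ), ?_, by simp, by simp, ?_⟩
    · rintro ⟨x, y⟩ (hq | hq)
      · exact Or.inr (by rw [show y = p.2 from hq.2]; exact h)
      · exact Or.inl (by rw [show x = 0 from hq.1]; simp)
    · exact IsPreconnected.union (0, p.2) (by simp) (by simp)
        (isPreconnected_univ.prod isPreconnected_singleton)
        (isPreconnected_singleton.prod isPreconnected_univ)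

lemma foldTwo_eq_zero {t : ℝ} : foldTwo t = 0 ↔ Real.sin (2 * t) = 0 := Real.arcsin_eq_zero_iff

lemma poles_subset_grid : poles ⊆ grid := by
  intro p hp
  have h := sin_norm_foldTwo_sq p
  have hp' : height p = -1 := by have : 1 + height p = 0 := hp; linarith
  rw [hp'] at h
  have h0 : Real.sin ‖((foldTwo p.1, foldTwo p.2) : ℝ × ℝ)‖ = 0 := by
    apply pow_eq_zero_iff two_ne_zero |>.1
    rw [h]; norm_num
  have hle : ‖((foldTwo p.1, foldTwo p.2) : ℝ × ℝ)‖ ≤ Real.pi / 2 := by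
    rw [norm_eq_max]
    exact max_le (abs_le.2 ⟨Real.neg_pi_div_two_le_arcsin _, Real.arcsin_le_pi_div_two _⟩)
      (abs_le.2 ⟨Real.neg_pi_div_two_le_arcsin _, Real.arcsin_le_pi_div_two _⟩)
  have hpi := Real.pi_pos
  have h1 : ‖((foldTwo p.1, foldTwo p.2) : ℝ × ℝ)‖ = 0 := by
    by_contra hne
    have := Real.sin_pos_of_pos_of_lt_pi
      (lt_of_le_of_ne (norm_nonneg ((foldTwo p.1, foldTwo p.2) : ℝ × ℝ)) (Ne.symm hne))
      (by linarith)
    linarith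
  rw [norm_eq_zero] at h1
  exact Or.inl (foldTwo_eq_zero.1 (congrArg Prod.fst h1))

lemma planar_grid (lam : ℝ) {p : ℝ × ℝ} (hp : p ∈ grid) :
    (planar lam p).1 = 0 ∨ (planar lam p).2 = 0 := by
  rcases hp with h | h
  · left; simp [planar, horiz, foldTwo_eq_zero.2 h]
  · right; simp [planar, horiz, foldTwo_eq_zero.2 h]

/-- The value 0 is taken only at centres of squares: at zeros, and by default at poles. All of them
lie on the grid. -/
lemma planar_ne_zero_of_notMem_grid {lam : ℝ} (hlam : 0 < lam) {p : ℝ × ℝ} (hp : p ∉ grid) :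
    planar lam p ≠ 0 := by
  intro h0
  have hpp : p ∉ poles := fun h => hp (poles_subset_grid h)
  obtain ⟨k, l, v, he, hv, rfl⟩ := exists_even_square hlam hpp
    (by rw [h0, euc_zero]; exact hlam.le)
  have := invZero_planar hlam he hv
  rw [h0, invZero, radIn_zero] at this
  subst this
  refine hp (Or.inl ?_)
  rw [chart, sin_two_chartOne]
  simp

/-- This symmetry carries the density of prepoles from the x-axis to the y-axis. -/
lemma planar_swap (lam : ℝ) (p : ℝ × ℝ) : planar lam p.swap = (planar lam p).swap := by
  have h1 : height p.swap = height p := by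
    simp only [height, Prod.fst_swap, Prod.snd_swap]
    rw [add_comm, abs_sub_comm]
  have h2 : ∀ q : ℝ × ℝ, horiz q.swap = (horiz q).swap := by
    intro q
    have : euc q.swap = euc q := by simp only [euc, Prod.fst_swap, Prod.snd_swap, add_comm]
    rw [horiz, horiz, this, norm_eq_max, norm_eq_max, Prod.fst_swap, Prod.snd_swap, max_comm]
    rfl
  rw [planar, planar, h1]
  rw [show (foldTwo p.swap.1, foldTwo p.swap.2) = (foldTwo p.1, foldTwo p.2).swap from rfl, h2]
  rfl

lemma swap_mem_prepoles {lam : ℝ} {p : ℝ × ℝ} (hp : p ∈ prepoles lam) :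
    p.swap ∈ prepoles lam := by
  obtain ⟨k, hk⟩ := hp
  refine ⟨k, ?_⟩
  rw [← Function.Semiconj.iterate_right (f := Prod.swap) (fun p => (planar_swap lam p).symm) k p]
  have h : ∀ q : ℝ × ℝ, height q.swap = height q := by
    intro q
    simp only [height, Prod.fst_swap, Prod.snd_swap]
    rw [add_comm, abs_sub_comm]
  rw [poles, Set.mem_ofPred_eq, h]
  exact hk

lemma mem_closure_prepoles {lam : ℝ} (h1 : 1 ≤ lam) {p : ℝ × ℝ} (hp : p.1 = 0 ∨ p.2 = 0) :
    p ∈ closure (prepoles lam) := by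
  have key : ∀ (x ε : ℝ), 0 < ε → ∃ y, (y, 0) ∈ prepoles lam ∧ |y - x| < ε := by
    intro x ε hε
    obtain ⟨y, hy, k, hk⟩ := exists_cos_iterate_eq_zero h1 (show x < x + ε / 2 by linarith)
    refine ⟨y, ⟨k, ?_⟩, abs_lt.2 ⟨by linarith [hy.1], by linarith [hy.2]⟩⟩
    rwa [iterate_planar_axis, mem_poles_axis]
  rw [Metric.mem_closure_iff]
  intro ε hε
  obtain ⟨x, y⟩ := p
  rcases hp with rfl | rfl
  · obtain ⟨z, hz, hzy⟩ := key y ε hε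
    have hz' := swap_mem_prepoles hz
    rw [Prod.swap_prod_mk] at hz'
    refine ⟨(0, z), hz', ?_⟩
    rw [dist_comm, dist_eq_norm, norm_eq_max]
    simpa using hzy
  · obtain ⟨z, hz, hzx⟩ := key x ε hε
    refine ⟨(z, 0), hz, ?_⟩
    rw [dist_comm, dist_eq_norm, norm_eq_max]
    simpa using hzx

lemma grid_subset_closure {lam : ℝ} (h1 : 1 ≤ lam) : grid ⊆ closure (planarEsc lam) := by
  have hlam : 0 < lam := by linarith
  intro p hp
  by_cases hpp : p ∈ poles
  · exact poles_subset_closure hlam hpp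
  · exact closure_planarEsc_backward hlam hpp
      (closure_minimal (prepoles_subset_closure hlam) isClosed_closure
        (mem_closure_prepoles h1 (planar_grid lam hp)))

/-- The points whose orbits hit the grid within `n` steps. -/
def gridPull (lam : ℝ) : ℕ → Set (ℝ × ℝ)
  | 0 => grid
  | n + 1 => {p | p ∈ grid ∨ planar lam p ∈ gridPull lam n}

lemma grid_subset_gridPull (lam : ℝ) (n : ℕ) : grid ⊆ gridPull lam n := by
  cases n with
  | zero => exact subset_rfl
  | succ n => exact fun p hp => Or.inl hp

/-- Continuity can fail only at poles, which lie in the grid; keeping the grid in every stage makes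
the pullbacks closed. -/
lemma isClosed_gridPull (lam : ℝ) (n : ℕ) : IsClosed (gridPull lam n) := by
  induction n with
  | zero => exact isClosed_grid
  | succ n ih =>
    refine isClosed_of_closure_subset fun p hp => ?_
    by_contra hne
    have hne' : ¬ (p ∈ grid ∨ planar lam p ∈ gridPull lam n) := hne
    push Not at hne'
    have hc := continuousAt_planar lam (fun h => hne'.1 (poles_subset_grid h))
    have hn : ∀ᶠ q in 𝓝 p, q ∉ grid ∧ planar lam q ∉ gridPull lam n :=
      (isClosed_grid.isOpen_compl.eventually_mem hne'.1).and
        (hc.eventually (ih.isOpen_compl.eventually_mem hne'.2))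
    obtain ⟨q, hq, hq'⟩ := (mem_closure_iff_frequently.1 hp).and_eventually hn |>.exists
    rcases hq with h | h
    · exact hq'.1 h
    · exact hq'.2 h

lemma gridPull_subset_closure {lam : ℝ} (h1 : 1 ≤ lam) (n : ℕ) :
    gridPull lam n ⊆ closure (planarEsc lam) := by
  induction n with
  | zero => exact grid_subset_closure h1
  | succ n ih =>
    rintro p (hp | hp)
    · exact grid_subset_closure h1 hp
    · by_cases hpp : p ∈ poles
      · exact poles_subset_closure (by linarith) hpp
      · exact closure_planarEsc_backward (by linarith) hpp (ih hp)

/-- A point off the grid lies in a compact cell bounded by the grid. -/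
lemma exists_cell {b : ℝ × ℝ} (hb : b ∉ grid) :
    ∃ O Q : Set (ℝ × ℝ), IsOpen O ∧ IsCompact Q ∧ b ∈ O ∧ O ⊆ Q ∧ Q \ grid ⊆ O := by
  have hpi := Real.pi_pos
  have key : ∀ x : ℝ, Real.sin (2 * x) ≠ 0 → ∃ s t : ℝ, s < x ∧ x < t ∧
      Real.sin (2 * s) = 0 ∧ Real.sin (2 * t) = 0 := by
    intro x hx
    have hs : ∀ n : ℤ, Real.sin (2 * (n * (Real.pi / 2))) = 0 := fun n => by
      rw [show 2 * ((n : ℝ) * (Real.pi / 2)) = n * Real.pi by ring, Real.sin_int_mul_pi]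
    refine ⟨⌊x / (Real.pi / 2)⌋ * (Real.pi / 2), (⌊x / (Real.pi / 2)⌋ + 1 : ℤ) * (Real.pi / 2),
      ?_, ?_, hs _, hs _⟩
    · refine lt_of_le_of_ne ?_ fun h => hx ?_
      · rw [← le_div_iff₀ (by positivity)]; exact Int.floor_le _
      · rw [← h]; exact hs _
    · rw [← div_lt_iff₀ (by positivity)]; push_cast; exact Int.lt_floor_add_one _
  have hb' : ¬ (Real.sin (2 * b.1) = 0 ∨ Real.sin (2 * b.2) = 0) := hb
  push Not at hb'
  obtain ⟨s, t, h1, h2, h3, h4⟩ := key b.1 hb'.1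
  obtain ⟨s', t', h1', h2', h3', h4'⟩ := key b.2 hb'.2
  refine ⟨Set.Ioo s t ×ˢ Set.Ioo s' t', Set.Icc s t ×ˢ Set.Icc s' t',
    isOpen_Ioo.prod isOpen_Ioo, isCompact_Icc.prod isCompact_Icc, ⟨⟨h1, h2⟩, ⟨h1', h2'⟩⟩,
    Set.prod_mono Set.Ioo_subset_Icc_self Set.Ioo_subset_Icc_self, ?_⟩
  rintro ⟨x, y⟩ ⟨⟨⟨a1, a2⟩, ⟨a3, a4⟩⟩, hg⟩
  have hg' : ¬ (Real.sin (2 * x) = 0 ∨ Real.sin (2 * y) = 0) := hg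
  push Not at hg'
  refine ⟨⟨lt_of_le_of_ne a1 ?_, lt_of_le_of_ne a2 ?_⟩,
    ⟨lt_of_le_of_ne a3 ?_, lt_of_le_of_ne a4 ?_⟩⟩
  · rintro rfl; exact hg'.1 h3
  · rintro rfl; exact hg'.1 h4
  · rintro rfl; exact hg'.2 h3'
  · rintro rfl; exact hg'.2 h4'

/-- The pulled back grid cannot be separated from the grid. -/
lemma gridPull_succ_no_separation {lam : ℝ} (hlam : 0 < lam) {n : ℕ}
    (hn : IsPreconnected (gridPull lam n)) {u v : Set (ℝ × ℝ)} (hu : IsOpen u) (hv : IsOpen v)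
    (hcov : gridPull lam (n + 1) ⊆ u ∪ v) (hgu : grid ⊆ u)
    (hne : (gridPull lam (n + 1) ∩ v).Nonempty) :
    (gridPull lam (n + 1) ∩ (u ∩ v)).Nonempty := by
  by_contra hdis
  have hdis' : ∀ p ∈ gridPull lam (n + 1), p ∈ u → p ∉ v :=
    fun p hp h1 h2 => hdis ⟨p, hp, h1, h2⟩
  obtain ⟨b, hbE, hbv⟩ := hne
  have hbg : b ∉ grid := fun h => hdis' b hbE (hgu h) hbv
  obtain ⟨O, Q, hO, hQ, hbO, hOQ, hQO⟩ := exists_cell hbg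
  -- The part of the pullback in v inside one cell. It is compact and off the grid; the aim is that
  -- its image is both open and closed in `gridPull lam n`.
  set B := gridPull lam (n + 1) ∩ v ∩ Q
  have hBg : ∀ p ∈ B, p ∉ grid := fun p hp h => hdis' p hp.1.1 (hgu h) hp.1.2
  have hB : IsCompact B := by
    have : B = Q ∩ (gridPull lam (n + 1) ∩ uᶜ) := by
      ext p
      constructor
      · rintro ⟨⟨h1, h2⟩, h3⟩
        exact ⟨h3, h1, fun h => hdis' p h1 h h2⟩
      · rintro ⟨h1, h2, h3⟩
        exact ⟨⟨h2, (hcov h2).resolve_left h3⟩, h1⟩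
    rw [this]
    exact hQ.inter_right ((isClosed_gridPull lam _).inter hu.isClosed_compl)
  have hBF : ∀ p ∈ B, planar lam p ∈ gridPull lam n := fun p hp =>
    hp.1.1.resolve_left (hBg p hp)
  have hBp : ∀ p ∈ B, p ∉ poles := fun p hp h => hBg p hp (poles_subset_grid h)
  have hFB : IsClosed (planar lam '' B) :=
    (hB.image_of_continuousOn fun p hp =>
      (continuousAt_planar lam (hBp p hp)).continuousWithinAt).isClosed
  -- Relative openness of the image: if its point `planar lam p` were a limit of the rest, openness
  -- of the map would give points of the pullback near p, hence in B, mapped into the rest.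
  have hrest : IsClosed (gridPull lam n \ planar lam '' B) := by
    refine isClosed_of_closure_subset fun q hq => ⟨?_, ?_⟩
    · exact closure_minimal Set.sdiff_subset (isClosed_gridPull lam n) hq
    · rintro ⟨p, hp, rfl⟩
      obtain ⟨p', hp', -, hp'E⟩ := mem_closure_iff.1
        (mem_closure_preimage hlam (hBp p hp) hq) (v ∩ O) (hv.inter hO)
        ⟨hp.1.2, hQO ⟨hp.2, hBg p hp⟩⟩
      exact hp'E.2 ⟨p', ⟨⟨Or.inr hp'E.1, hp'.1⟩, hOQ hp'.2⟩, rfl⟩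
  -- The origin shows that the image is a proper part of `gridPull lam n`, contradicting
  -- connectedness.
  have h0 : (0 : ℝ × ℝ) ∉ planar lam '' B := by
    rintro ⟨p, hp, h⟩
    exact planar_ne_zero_of_notMem_grid hlam (hBg p hp) h
  have h0n : (0 : ℝ × ℝ) ∈ gridPull lam n := grid_subset_gridPull lam n zero_mem_grid
  have hbB : b ∈ B := ⟨⟨hbE, hbv⟩, hOQ hbO⟩
  obtain ⟨q, -, hq1, hq2⟩ := isPreconnected_closed_iff.1 hn _ _ hFB hrest
    (fun q hq => (em (q ∈ planar lam '' B)).imp id fun h => ⟨hq, h⟩)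
    ⟨planar lam b, hBF b hbB, b, hbB, rfl⟩ ⟨0, h0n, h0n, h0⟩
  exact hq2.2 hq1

lemma isPreconnected_gridPull {lam : ℝ} (hlam : 0 < lam) (n : ℕ) :
    IsPreconnected (gridPull lam n) := by
  induction n with
  | zero => exact isPreconnected_grid
  | succ n ih =>
    intro u v hu hv hcov hnu hnv
    have hg := grid_subset_gridPull lam (n + 1)
    by_cases hgv : (grid ∩ v).Nonempty
    · by_cases hgu : (grid ∩ u).Nonempty
      · obtain ⟨p, hp, hp'⟩ := isPreconnected_grid u v hu hv (hg.trans hcov) hgu hgv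
        exact ⟨p, hg hp, hp'⟩
      · have hsub : grid ⊆ v := fun p hp =>
          (hcov (hg hp)).resolve_left fun h => hgu ⟨p, hp, h⟩
        rw [Set.inter_comm u v]
        exact gridPull_succ_no_separation hlam ih hv hu (by rwa [Set.union_comm]) hsub hnu
    · have hsub : grid ⊆ u := fun p hp =>
        (hcov (hg hp)).resolve_right fun h => hgv ⟨p, hp, h⟩
      exact gridPull_succ_no_separation hlam ih hu hv hcov hsub hnv

lemma mem_gridPull_of_iterate {lam : ℝ} {k : ℕ} {p : ℝ × ℝ}
    (h : (planar lam)^[k] p ∈ grid) : p ∈ gridPull lam k := by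
  induction k generalizing p with
  | zero => exact h
  | succ k ih => exact Or.inr (ih (by rwa [Function.iterate_succ_apply] at h))

lemma norm_sub_le_of_avoid_grid {S : Set (ℝ × ℝ)} (hS : IsPreconnected S)
    (h : ∀ p ∈ S, p ∉ grid) {p q : ℝ × ℝ} (hp : p ∈ S) (hq : q ∈ S) :
    ‖p - q‖ ≤ Real.pi := by
  have hpi := Real.pi_pos
  have key : ∀ (f : ℝ × ℝ → ℝ), Continuous f → (∀ p, Real.sin (2 * f p) = 0 → p ∈ grid) →
      |f p - f q| ≤ Real.pi := by
    intro f hf hd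
    have := IsPreconnected.abs_sub_lt_of_avoid (hS.image f hf.continuousOn) (d := 0)
      (c := Real.pi / 2) (by positivity) (by
        rintro n ⟨w, hw, hn⟩
        refine h w hw (hd w ?_)
        rw [hn, show 2 * ((n : ℝ) * (Real.pi / 2) + 0) = n * Real.pi by ring,
          Real.sin_int_mul_pi]) ⟨p, hp, rfl⟩ ⟨q, hq, rfl⟩
    linarith
  rw [norm_eq_max]
  exact max_le (key _ continuous_fst fun p hp => Or.inl hp)
    (key _ continuous_snd fun p hp => Or.inr hp)

/-- A ball around an escaping point that misses all pullbacks has all its images inside cells of the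
grid, so expansion would reduce the ball to a point. -/
lemma planarEsc_subset_closure_gridPull {lam : ℝ} (hlam : 0 < lam) :
    planarEsc lam ⊆ closure (⋃ n, gridPull lam n) := by
  intro p hp
  by_contra hne
  obtain ⟨ε, hε, hball⟩ := Metric.isOpen_iff.1 isClosed_closure.isOpen_compl p hne
  have hgrid : ∀ q ∈ Metric.ball p ε, ∀ k : ℕ, (planar lam)^[k] q ∉ grid := fun q hq k h =>
    hball hq (subset_closure (Set.mem_iUnion.2 ⟨k, mem_gridPull_of_iterate h⟩))
  have hpre : ∀ q ∈ Metric.ball p ε, q ∉ prepoles lam := by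
    rintro q hq ⟨k, hk⟩
    exact hgrid q hq k (poles_subset_grid hk)
  have hconn : IsPreconnected (Metric.ball p ε) := (convex_ball p ε).isPreconnected
  have hpb := Metric.mem_ball_self (x := p) hε
  have hsub := subsingleton_of_escaping hlam hconn hpre hpb hp (R := Real.pi) (by
    intro k q hq
    refine norm_sub_le_of_avoid_grid
      (hconn.image _ fun q hq => (continuousAt_iterate (hpre q hq) k).continuousWithinAt) ?_
      ⟨q, hq, rfl⟩ ⟨p, hpb, rfl⟩
    rintro _ ⟨w, hw, rfl⟩
    exact hgrid w hw k)
  have hq : p + (ε / 2, 0) ∈ Metric.ball p ε := by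
    rw [Metric.mem_ball, dist_eq_norm, norm_eq_max]
    simp only [add_sub_cancel_left, abs_zero]
    rw [abs_of_pos (by positivity)]
    exact max_lt (by linarith) hε
  have := congrArg Prod.fst (hsub hq hpb)
  simp only [Prod.fst_add] at this
  linarith

theorem isPreconnected_closure_planarEsc {lam : ℝ} (h1 : 1 ≤ lam) :
    IsPreconnected (closure (planarEsc lam)) := by
  have hlam : 0 < lam := by linarith
  have : closure (planarEsc lam) = closure (⋃ n, gridPull lam n) :=
    Set.Subset.antisymm
      (closure_minimal (planarEsc_subset_closure_gridPull hlam) isClosed_closure)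
      (closure_minimal (Set.iUnion_subset (gridPull_subset_closure h1)) isClosed_closure)
  rw [this]
  refine IsPreconnected.closure ?_
  exact isPreconnected_iUnion
    ⟨0, Set.mem_iInter.2 fun n => grid_subset_gridPull lam n zero_mem_grid⟩
    (isPreconnected_gridPull hlam)

/-! ### Iterates with and without the point at infinity -/

section Iterates

variable {X : Type*} {f : X → OnePoint X} {F : X → X} {P : Set X}

lemma iter_eq_iterate (hF : ∀ x ∉ P, f x = F x) {k : ℕ} {x : X} (h : ∀ i < k, F^[i] x ∉ P) :
    iter f k x = (F^[k] x : X) := by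
  induction k with
  | zero => rfl
  | succ k ih =>
    rw [iter, ih fun i hi => h i (by omega), OnePoint.elim_some, hF _ (h k (by omega)),
      Function.iterate_succ_apply']

lemma backwardOrbitInfty_eq (hP : ∀ x ∈ P, f x = OnePoint.infty) (hF : ∀ x ∉ P, f x = F x) :
    backwardOrbitInfty f = {x | ∃ k : ℕ, F^[k] x ∈ P} := by
  classical
  ext x
  constructor
  · rintro ⟨k, -, hk⟩
    by_contra hne
    have h : ∀ i < k, F^[i] x ∉ P := fun i _ hi => hne ⟨i, hi⟩
    rw [iter_eq_iterate hF h] at hk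
    exact OnePoint.coe_ne_infty _ hk
  · intro h
    -- The orbit is in P one step before it takes the value ∞.
    refine ⟨Nat.find h + 1, by omega, ?_⟩
    rw [iter, iter_eq_iterate hF fun i hi => Nat.find_min h hi, OnePoint.elim_some]
    exact hP _ (Nat.find_spec h)

lemma escapingSet_eq [TopologicalSpace X] (hP : ∀ x ∈ P, f x = OnePoint.infty)
    (hF : ∀ x ∉ P, f x = F x) :
    escapingSet f = {x | (∀ k : ℕ, F^[k] x ∉ P) ∧
      Tendsto (fun k : ℕ => F^[k] x) atTop (coclosedCompact X)} := by
  ext x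
  rw [escapingSet, Set.mem_ofPred_eq, backwardOrbitInfty_eq hP hF]
  simp only [Set.mem_ofPred_eq, not_exists]
  refine and_congr_right fun h => ?_
  rw [← OnePoint.comap_coe_nhds_infty, tendsto_comap_iff]
  refine tendsto_congr fun k => ?_
  exact iter_eq_iterate hF fun i _ => h i

end Iterates

/-! ### The map in space -/

/-- The squared distance of the Zorich image from the south pole. -/
def denom (p : E3) : ℝ :=
  zorich ((2 : ℝ) • p) 0 ^ 2 + zorich ((2 : ℝ) • p) 1 ^ 2 + (zorich ((2 : ℝ) • p) 2 + 1) ^ 2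

/-- The scaled tangent map off its poles. -/
def spatial (lam : ℝ) (p : E3) : E3 :=
  lam • !₂[2 * (1 / denom p) * zorich ((2 : ℝ) • p) 0, 2 * (1 / denom p) * zorich ((2 : ℝ) • p) 1,
    1 - 2 * (1 / denom p) * (zorich ((2 : ℝ) • p) 2 + 1)]

lemma genTanScaled_of_denom_eq_zero (lam : ℝ) {p : E3} (h : denom p = 0) :
    genTanScaled lam p = OnePoint.infty := by
  have : genTan p = OnePoint.infty := if_pos h
  rw [genTanScaled, this]
  rfl

lemma genTanScaled_of_denom_ne_zero (lam : ℝ) {p : E3} (h : denom p ≠ 0) :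
    genTanScaled lam p = (spatial lam p : E3) := by
  have : genTan p = (!₂[2 * (1 / denom p) * zorich ((2 : ℝ) • p) 0,
    2 * (1 / denom p) * zorich ((2 : ℝ) • p) 1,
    1 - 2 * (1 / denom p) * (zorich ((2 : ℝ) • p) 2 + 1)] : E3) := if_neg h
  rw [genTanScaled, this]
  rfl

lemma fold_two_mul {k : ℤ} {a x : ℝ} (hx : x = chartOne k a)
    (hk : k = round (x / (Real.pi / 2))) : fold (2 * x) = 2 * a ∧ foldSign (2 * x) = sgn k := by
  have hk' : round (2 * x / Real.pi) = k := by
    rw [hk]; congr 1; field_simp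
  rw [fold, foldSign, hk']
  refine ⟨?_, rfl⟩
  change sgn k * _ = _
  have : 2 * x - k * Real.pi = sgn k * (2 * a) := by rw [hx, chartOne]; ring
  rw [this, ← mul_assoc, sgn_mul_self, one_mul]

/-- The horizontal part of the Zorich map on the plane `z = 0`, in the doubled variable. -/
def horizPart (p : E3) : ℝ × ℝ := horiz (foldTwo (p 0), foldTwo (p 1))

/-- The indices from `exists_chart` are the rounded ones used in `fold` and `foldSign`, which
identifies the definition by rounding with expressions that are visibly continuous. -/
lemma zorich_two_smul (p : E3) : zorich ((2 : ℝ) • p) =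
    !₂[Real.exp (2 * p 2) * (horizPart p).1, Real.exp (2 * p 2) * (horizPart p).2,
      Real.exp (2 * p 2) * height (p 0, p 1)] := by
  obtain ⟨k, l, v, hv, hp, hk, hl⟩ := exists_chart (p 0, p 1)
  have hp0 : p 0 = chartOne k v.1 := congrArg Prod.fst hp
  have hp1 : p 1 = chartOne l v.2 := congrArg Prod.snd hp
  have h1 : |v.1| ≤ Real.pi / 4 := (le_max_left _ _).trans (norm_eq_max v ▸ hv)
  have h2 : |v.2| ≤ Real.pi / 4 := (le_max_right _ _).trans (norm_eq_max v ▸ hv)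
  obtain ⟨f1, s1⟩ := fold_two_mul hp0 hk
  obtain ⟨f2, s2⟩ := fold_two_mul hp1 hl
  have g1 : foldTwo (p 0) = 2 * v.1 := by rw [hp0, foldTwo_chartOne k h1]
  have g2 : foldTwo (p 1) = 2 * v.2 := by rw [hp1, foldTwo_chartOne l h2]
  have hm : maxAbs (2 * v.1) (2 * v.2) = 2 * ‖v‖ := by
    rw [maxAbs, norm_eq_max, abs_mul, abs_mul, abs_two, mul_max_of_nonneg _ _ (by norm_num)]
  have hn : ‖((2 * v.1, 2 * v.2) : ℝ × ℝ)‖ = 2 * ‖v‖ := by rw [norm_eq_max, ← hm]; rfl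
  have hh : height (p 0, p 1) = sgn k * sgn l * Real.cos (2 * ‖v‖) := by
    rw [hp, height_chart k l hv, sgn_add]
  ext i
  fin_cases i
  · simp [zorich, hemisphereMap, horizPart, horiz, f1, f2, g1, g2, hm, hn, euc]
    ring
  · simp [zorich, hemisphereMap, horizPart, horiz, f1, f2, g1, g2, hm, hn, euc]
    ring
  · simp [zorich, hemisphereMap, f1, f2, s1, s2, hm, hh]
    ring

lemma horizPart_sq (p : E3) :
    (horizPart p).1 ^ 2 + (horizPart p).2 ^ 2 = 1 - height (p 0, p 1) ^ 2 := by
  rw [← euc_sq, horizPart, euc_horiz, sq_abs]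
  exact sin_norm_foldTwo_sq (p 0, p 1)

lemma denom_eq (p : E3) :
    denom p = Real.exp (2 * p 2) ^ 2 + 2 * Real.exp (2 * p 2) * height (p 0, p 1) + 1 := by
  have h := horizPart_sq p
  rw [denom, zorich_two_smul]
  simp
  linear_combination Real.exp (2 * p 2) ^ 2 * h

/-- Since the height is at least -1. Hence all poles lie in the plane z = 0. -/
lemma sq_le_denom (p : E3) : (Real.exp (2 * p 2) - 1) ^ 2 ≤ denom p := by
  have h := (abs_le.1 (abs_height_le_one (p 0, p 1))).1
  have hE := Real.exp_pos (2 * p 2)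
  rw [denom_eq]
  nlinarith

lemma denom_pos {p : E3} (hp : p 2 ≠ 0) : 0 < denom p := by
  refine lt_of_lt_of_le ?_ (sq_le_denom p)
  have : Real.exp (2 * p 2) - 1 ≠ 0 := by
    rw [sub_ne_zero, Ne, Real.exp_eq_one_iff]
    simpa using hp
  positivity

lemma spatial_apply_two (lam : ℝ) {p : E3} (h : denom p ≠ 0) :
    spatial lam p 2 = lam * (Real.exp (2 * p 2) ^ 2 - 1) / denom p := by
  have hd := denom_eq p
  simp only [spatial, zorich_two_smul]
  simp
  field_simp
  rw [hd]
  ring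

lemma spatial_apply_two_ne_zero {lam : ℝ} (hlam : 0 < lam) {p : E3} (hp : p 2 ≠ 0) :
    spatial lam p 2 ≠ 0 := by
  have h := denom_pos hp
  rw [spatial_apply_two lam h.ne']
  refine div_ne_zero (mul_ne_zero hlam.ne' ?_) h.ne'
  rw [sub_ne_zero, ← Real.exp_nat_mul, Ne, Real.exp_eq_one_iff]
  simpa using hp

/-- For w = Z(2p) the Möbius map satisfies |A(w)| = |w - e₃| / |w + e₃|, where |w + e₃|² is `denom
p` and |w - e₃|² is the last bracket. -/
lemma norm_spatial_sq_mul (lam : ℝ) {p : E3} (h : denom p ≠ 0) :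
    ‖spatial lam p‖ ^ 2 * denom p
      = lam ^ 2 * (denom p - 4 * Real.exp (2 * p 2) * height (p 0, p 1)) := by
  have hd := denom_eq p
  have hw := horizPart_sq p
  rw [EuclideanSpace.norm_sq_eq, Fin.sum_univ_three, spatial_apply_two lam h]
  simp only [spatial, zorich_two_smul, Real.norm_eq_abs, sq_abs]
  simp
  field_simp
  have e : denom p * (denom p - 4 * Real.exp (2 * p 2) * height (p 0, p 1))
      = 4 * Real.exp (2 * p 2) ^ 2 * (1 - height (p 0, p 1) ^ 2)
        + (Real.exp (2 * p 2) ^ 2 - 1) ^ 2 := by rw [hd]; ring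
  rw [← hw] at e
  linear_combination -lam ^ 2 * e

lemma abs_mul_le_abs_exp_sub_one (t : ℝ) : min 1 (Real.exp t) * |t| ≤ |Real.exp t - 1| := by
  rcases le_total 0 t with h | h
  · have h1 := Real.add_one_le_exp t
    rw [abs_of_nonneg h, abs_of_nonneg (by linarith), min_eq_left (by linarith)]
    linarith
  · have h1 := Real.add_one_le_exp (-t)
    have h2 : Real.exp t * Real.exp (-t) = 1 := by rw [← Real.exp_add]; simp
    have h3 := Real.exp_pos t
    have h4 : Real.exp t ≤ 1 := Real.exp_le_one_iff.2 h
    rw [abs_of_nonpos h, abs_of_nonpos (by linarith), min_eq_right h4]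
    nlinarith

/-- Where the tangent map is large the third coordinate is small, and it does not decrease. -/
lemma height_grows {lam ε : ℝ} (hlam : 0 < lam) (hε : 0 < ε) (hε8 : ε ≤ 1 / 8)
    (hεl : 2 * ε ≤ lam) {p : E3} (hp : p 2 ≠ 0)
    (hlarge : lam ^ 2 * (1 + 4 / ε) ≤ ‖spatial lam p‖ ^ 2) :
    p 2 ^ 2 ≤ 2 * ε ∧ |p 2| ≤ |spatial lam p 2| := by
  have hd := denom_pos hp
  have hsq := sq_le_denom p
  have hn := norm_spatial_sq_mul lam hd.ne'
  have hl := spatial_apply_two lam hd.ne'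
  have hc := (abs_le.1 (abs_height_le_one (p 0, p 1))).1
  have hexp := abs_mul_le_abs_exp_sub_one (2 * p 2)
  have hE := Real.exp_pos (2 * p 2)
  set E := Real.exp (2 * p 2)
  set d := denom p
  have hl2 : 0 < lam ^ 2 := by positivity
  -- A large image means that the Zorich image is near the south pole; the height is bounded below
  -- by -1.
  have hdE : d ≤ ε * E := by
    have h1 : lam ^ 2 * (1 + 4 / ε) * d ≤ lam ^ 2 * (d - 4 * E * height (p 0, p 1)) := by
      rw [← hn]; exact mul_le_mul_of_nonneg_right hlarge hd.le
    rw [mul_assoc] at h1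
    have h2 := le_of_mul_le_mul_left h1 hl2
    have h3 : 4 / ε * d ≤ 4 * E := by nlinarith
    rw [div_mul_eq_mul_div, div_le_iff₀ hε] at h3
    linarith
  have hE2 : E < 2 := by
    by_contra! h
    nlinarith
  have hd2 : d ≤ 2 * ε := by nlinarith
  have hEhalf : 1 / 2 ≤ E := by
    by_contra! h
    nlinarith
  have hz : |p 2| ≤ |E - 1| := by
    refine le_trans ?_ hexp
    rw [abs_mul, abs_two]
    have : 1 / 2 ≤ min 1 E := le_min (by norm_num) hEhalf
    nlinarith [abs_nonneg (p 2)]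
  constructor
  · rw [← sq_abs]
    have := pow_le_pow_left₀ (abs_nonneg _) hz 2
    rw [sq_abs (E - 1)] at this
    linarith
  -- The new third coordinate has modulus lam |E - 1| (E + 1) / d, and d ≤ 2ε ≤ lam.
  · refine hz.trans ?_
    rw [hl, abs_div, abs_of_pos hd, le_div_iff₀ hd, abs_mul, abs_of_pos hlam,
      show E ^ 2 - 1 = (E - 1) * (E + 1) by ring, abs_mul, abs_of_pos (by linarith : 0 < E + 1)]
    have h0 := abs_nonneg (E - 1)
    have h1 : |E - 1| * d ≤ |E - 1| * lam := mul_le_mul_of_nonneg_left (by linarith) h0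
    nlinarith [mul_nonneg h0 hlam.le]

lemma iterate_spatial_two_ne_zero {lam : ℝ} (hlam : 0 < lam) {p : E3} (hp : p 2 ≠ 0) (k : ℕ) :
    (spatial lam)^[k] p 2 ≠ 0 := by
  induction k with
  | zero => exact hp
  | succ k ih =>
    rw [Function.iterate_succ_apply']
    exact spatial_apply_two_ne_zero hlam ih

/-- No point off the plane `z = 0` escapes. -/
lemma not_escaping_of_two_ne_zero {lam : ℝ} (hlam : 0 < lam) {p : E3} (hp : p 2 ≠ 0) :
    ¬ Tendsto (fun k : ℕ => ‖(spatial lam)^[k] p‖) atTop atTop := by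
  intro ht
  have hev : ∀ ε > 0, ε ≤ 1 / 8 → 2 * ε ≤ lam → ∃ K, ∀ k ≥ K,
      (spatial lam)^[k] p 2 ^ 2 ≤ 2 * ε ∧
      |(spatial lam)^[k] p 2| ≤ |(spatial lam)^[k + 1] p 2| := by
    intro ε hε h8 hl
    obtain ⟨K, hK⟩ := eventually_atTop.1 (ht.eventually_ge_atTop (lam ^ 2 * (1 + 4 / ε) + 1))
    refine ⟨K, fun k hk => ?_⟩
    rw [Function.iterate_succ_apply']
    refine height_grows hlam hε h8 hl (iterate_spatial_two_ne_zero hlam hp k) ?_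
    rw [← Function.iterate_succ_apply' (spatial lam)]
    have := hK (k + 1) (by omega)
    have h0 : 0 ≤ lam ^ 2 * (1 + 4 / ε) := by positivity
    nlinarith
  -- A first choice of ε makes |z| nondecreasing from time K on, hence at least η > 0.
  obtain ⟨K, hK⟩ := hev (min (1 / 8) (lam / 2)) (by positivity) (min_le_left _ _)
    (by linarith [min_le_right (1 / 8 : ℝ) (lam / 2)])
  set η := |(spatial lam)^[K] p 2|
  have hη : 0 < η := abs_pos.2 (iterate_spatial_two_ne_zero hlam hp K)
  have hmono : ∀ j : ℕ, η ≤ |(spatial lam)^[K + j] p 2| := by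
    intro j
    induction j with
    | zero => exact le_rfl
    | succ j ih => exact ih.trans (hK (K + j) (by omega)).2
  have m1 := min_le_left (min (1 / 8) (lam / 2)) (η ^ 2 / 4)
  have m2 := min_le_right (min (1 / 8) (lam / 2)) (η ^ 2 / 4)
  -- A second choice with ε ≤ η²/4 forces z² ≤ η²/2 at later times, a contradiction.
  obtain ⟨K', hK'⟩ := hev (min (min (1 / 8) (lam / 2)) (η ^ 2 / 4)) (by positivity)
    (m1.trans (min_le_left _ _))
    (by linarith [min_le_right (1 / 8 : ℝ) (lam / 2)])
  have h1 := (hK' (K + K') (by omega)).1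
  have h2 := pow_le_pow_left₀ hη.le (hmono K') 2
  rw [sq_abs ((spatial lam)^[K + K'] p 2)] at h2
  have h3 : 0 < η ^ 2 := by positivity
  linarith

/-! ### The invariant plane -/

/-- The inclusion of the plane `z = 0`. -/
def incl (q : ℝ × ℝ) : E3 := !₂[q.1, q.2, 0]

/-- The vertical projection. -/
def proj (p : E3) : ℝ × ℝ := (p 0, p 1)

lemma proj_incl (q : ℝ × ℝ) : proj (incl q) = q := by simp [proj, incl]

lemma incl_proj {p : E3} (hp : p 2 = 0) : incl (proj p) = p := by
  ext i
  fin_cases i <;> simp [incl, proj, hp]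

lemma continuous_proj : Continuous proj := by unfold proj; fun_prop

lemma continuous_incl : Continuous incl := by
  unfold incl
  refine (PiLp.continuous_toLp 2 _).comp (continuous_pi fun i => ?_)
  fin_cases i
  · exact continuous_fst
  · exact continuous_snd
  · exact continuous_const

lemma isClosedEmbedding_incl : IsClosedEmbedding incl :=
  Function.LeftInverse.isClosedEmbedding proj_incl continuous_proj continuous_incl

lemma norm_incl (q : ℝ × ℝ) : ‖incl q‖ = euc q := by
  rw [EuclideanSpace.norm_eq, Fin.sum_univ_three, euc]
  simp [incl]

lemma denom_incl (q : ℝ × ℝ) : denom (incl q) = 2 * (1 + height q) := by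
  rw [denom_eq]
  simp [incl]
  ring

lemma denom_incl_eq_zero (q : ℝ × ℝ) : denom (incl q) = 0 ↔ q ∈ poles := by
  rw [denom_incl, poles, Set.mem_ofPred_eq]
  constructor <;> intro h <;> linarith

lemma spatial_incl (lam : ℝ) {q : ℝ × ℝ} (hq : q ∉ poles) :
    spatial lam (incl q) = incl (planar lam q) := by
  have h : 1 + height q ≠ 0 := hq
  have hd := denom_incl q
  have hd0 : denom (incl q) ≠ 0 := by rwa [Ne, denom_incl_eq_zero]
  ext i
  fin_cases i
  · simp only [spatial, zorich_two_smul, hd]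
    simp [incl, planar, horizPart]
    field_simp
  · simp only [spatial, zorich_two_smul, hd]
    simp [incl, planar, horizPart]
    field_simp
  · have := spatial_apply_two lam hd0
    simpa [incl] using this

lemma iterate_spatial_incl (lam : ℝ) {q : ℝ × ℝ} {k : ℕ}
    (h : ∀ i < k, (planar lam)^[i] q ∉ poles) :
    (spatial lam)^[k] (incl q) = incl ((planar lam)^[k] q) := by
  induction k with
  | zero => rfl
  | succ k ih =>
    rw [Function.iterate_succ_apply', Function.iterate_succ_apply', ih fun i hi => h i (by omega),
      spatial_incl lam (h k (by omega))]

lemma exists_denom_iterate_incl (lam : ℝ) (q : ℝ × ℝ) :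
    (∃ k : ℕ, denom ((spatial lam)^[k] (incl q)) = 0) ↔ q ∈ prepoles lam := by
  classical
  constructor
  · rintro ⟨k, hk⟩
    by_contra hne
    rw [iterate_spatial_incl lam fun i _ hi => hne ⟨i, hi⟩, denom_incl_eq_zero] at hk
    exact hne ⟨k, hk⟩
  · intro h
    refine ⟨Nat.find h, ?_⟩
    rw [iterate_spatial_incl lam fun i hi => Nat.find_min h hi, denom_incl_eq_zero]
    exact Nat.find_spec h

theorem backwardOrbitInfty_genTanScaled {lam : ℝ} (hlam : 0 < lam) :
    backwardOrbitInfty (genTanScaled lam) = incl '' prepoles lam := by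
  rw [backwardOrbitInfty_eq (P := {p | denom p = 0}) (F := spatial lam)
    (fun p hp => genTanScaled_of_denom_eq_zero lam hp)
    (fun p hp => genTanScaled_of_denom_ne_zero lam hp)]
  ext p
  constructor
  · intro hp
    have h2 : p 2 = 0 := by
      by_contra h
      obtain ⟨k, hk⟩ := hp
      exact (denom_pos (iterate_spatial_two_ne_zero hlam h k)).ne' hk
    rw [← incl_proj h2] at hp ⊢
    exact ⟨_, (exists_denom_iterate_incl lam _).1 hp, rfl⟩
  · rintro ⟨q, hq, rfl⟩
    exact (exists_denom_iterate_incl lam _).2 hq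

theorem escapingSet_genTanScaled {lam : ℝ} (hlam : 0 < lam) :
    escapingSet (genTanScaled lam) = incl '' planarEsc lam := by
  rw [escapingSet_eq (P := {p | denom p = 0}) (F := spatial lam)
    (fun p hp => genTanScaled_of_denom_eq_zero lam hp)
    (fun p hp => genTanScaled_of_denom_ne_zero lam hp),
    coclosedCompact_eq_cocompact, ← Metric.cobounded_eq_cocompact]
  have key : ∀ q : ℝ × ℝ, ((∀ k : ℕ, (spatial lam)^[k] (incl q) ∉ {p | denom p = 0}) ∧
      Tendsto (fun k : ℕ => (spatial lam)^[k] (incl q)) atTop (Bornology.cobounded E3)) ↔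
      q ∈ planarEsc lam := by
    intro q
    have h1 : (∀ k : ℕ, (spatial lam)^[k] (incl q) ∉ {p | denom p = 0}) ↔ q ∉ prepoles lam := by
      rw [← exists_denom_iterate_incl lam q, not_exists]; rfl
    rw [h1]
    refine and_congr_right fun hq => ?_
    have h2 : ∀ k : ℕ, (spatial lam)^[k] (incl q) = incl ((planar lam)^[k] q) := fun k =>
      iterate_spatial_incl lam fun i _ hi => hq ⟨i, hi⟩
    simp only [h2]
    rw [← tendsto_norm_atTop_iff_cobounded]
    simp only [norm_incl]
    constructor
    · intro h
      refine tendsto_atTop_mono (fun k => ?_) (h.atTop_div_const (by norm_num : (0 : ℝ) < 2))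
      linarith [euc_le_two_norm ((planar lam)^[k] q)]
    · exact fun h => tendsto_atTop_mono (fun k => norm_le_euc _) h
  ext p
  constructor
  · intro hp
    have h2 : p 2 = 0 := by
      by_contra h
      exact not_escaping_of_two_ne_zero hlam h (tendsto_norm_atTop_iff_cobounded.2 hp.2)
    rw [← incl_proj h2] at hp ⊢
    exact ⟨_, (key _).1 hp, rfl⟩
  · rintro ⟨q, hq, rfl⟩
    exact (key _).2 hq

theorem closure_escapingSet {lam : ℝ} (hlam : 0 < lam) :
    closure (escapingSet (genTanScaled lam)) = incl '' closure (planarEsc lam) := by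
  rw [escapingSet_genTanScaled hlam, isClosedEmbedding_incl.closure_image_eq]

lemma connectedComponentIn_eq_singleton {lam : ℝ} (hlam : 0 < lam) (h1 : lam < 1) {v : E3}
    (hv : v ∈ backwardOrbitInfty (genTanScaled lam) ∪ escapingSet (genTanScaled lam)) :
    connectedComponentIn (closure (escapingSet (genTanScaled lam))) v = {v} := by
  rw [backwardOrbitInfty_genTanScaled hlam, escapingSet_genTanScaled hlam, ← Set.image_union] at hv
  rw [closure_escapingSet hlam]
  obtain ⟨q, hq, rfl⟩ := hv
  have hqC : q ∈ closure (planarEsc lam) :=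
    hq.elim (fun h => prepoles_subset_closure hlam h) fun h => subset_closure h
  have hmem := mem_connectedComponentIn (Set.mem_image_of_mem incl hqC)
  have hsub := connectedComponentIn_subset (incl '' closure (planarEsc lam)) (incl q)
  set L := connectedComponentIn (incl '' closure (planarEsc lam)) (incl q)
  have hL : IsPreconnected (proj '' L) :=
    isPreconnected_connectedComponentIn.image _ continuous_proj.continuousOn
  have hLC : proj '' L ⊆ closure (planarEsc lam) := by
    rintro _ ⟨p, hp, rfl⟩
    obtain ⟨w, hw, rfl⟩ := hsub hp
    rwa [proj_incl]
  have hqL : q ∈ proj '' L := ⟨_, hmem, proj_incl q⟩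
  have hss := subsingleton_of_lt_one hlam h1 hL hLC hqL hq
  refine Set.Subset.antisymm (fun p hp => ?_) (Set.singleton_subset_iff.2 hmem)
  obtain ⟨w, hw, rfl⟩ := hsub hp
  have : w = q := hss ⟨_, hp, proj_incl w⟩ hqL
  rw [this]
  rfl

end TangentMap

end

/-! ### Conclusion for the map in space -/

theorem theorem2p4 (lam : ℝ) (hlam : 0 < lam) :
    (1 ≤ lam →
      IsConnected (closure (TangentMap.escapingSet (TangentMap.genTanScaled lam)))) ∧
    (lam < 1 →
      ¬ IsPreconnected (closure (TangentMap.escapingSet (TangentMap.genTanScaled lam))) ∧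
      ∀ v ∈ TangentMap.backwardOrbitInfty (TangentMap.genTanScaled lam) ∪
          TangentMap.escapingSet (TangentMap.genTanScaled lam),
        connectedComponentIn
          (closure (TangentMap.escapingSet (TangentMap.genTanScaled lam))) v = {v}) := by
  open TangentMap in
  refine ⟨fun h1 => ?_, fun h1 => ⟨fun hconn => ?_, fun v hv => ?_⟩⟩
  · rw [closure_escapingSet hlam]
    exact ⟨(planarEsc_nonempty hlam).closure.image _,
      (isPreconnected_closure_planarEsc h1).image _ continuous_incl.continuousOn⟩
  · obtain ⟨p, hp⟩ := planarEsc_nonempty hlam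
    -- A second escaping point, distinguished from p by its norm: a connected closure would coincide
    -- with the component of p, which is a singleton.
    obtain ⟨q, hq, hn⟩ := exists_mem_planarEsc_norm_ge hlam (‖p‖ + 1)
    have hmem : ∀ p ∈ planarEsc lam, incl p ∈ escapingSet (genTanScaled lam) := fun p hp => by
      rw [escapingSet_genTanScaled hlam]; exact ⟨p, hp, rfl⟩
    have h := connectedComponentIn_eq_singleton hlam h1 (Or.inr (hmem p hp))
    rw [hconn.connectedComponentIn (subset_closure (hmem p hp))] at h
    have hqp : incl q ∈ ({incl p} : Set E3) := h ▸ subset_closure (hmem q hq)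
    rw [isClosedEmbedding_incl.injective hqp] at hn
    linarith
  · exact connectedComponentIn_eq_singleton hlam h1 hv
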